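/- Let $d\ge 1$, $\alpha>0$ and $r>0$. For a bounded open set $\Omega\subset\mathbb{R}^d$ with Lipschitz boundary let $$\lambda_1(\Omega)=\inf_{v\in H^1(\Omega)\setminus\{0\}}\frac{\int_\Omega|\nabla v|^2\,dx-\alpha\int_{\partial\Omega}v^2\,d\sigma}{\int_\Omega v^2\,dx}$$ be the first eigenvalue of the Robin problem $-\Delta u=\lambda u$ in $\Omega$, $\frac{\partial u}{\partial\nu}=\alpha u$ on $\partial\Omega$, where $\nu$ is the outward unit normal, $\sigma$ is the $(d-1)$-dimensional Hausdorff measure and $v$ is understood on $\partial\Omega$ in the sense of traces. Let $B_\rho$ be the open ball of radius $\rho$ centred at the origin, and for $0<\rho_1<\rho_2$ let $A_{\rho_1,\rho_2}=B_{\rho_2}\setminus\overline{B}_{\rho_1}$. Then $\lambda_1(B_r)>-\infty$, and there is $\varepsilon_0>0$ (depending on $d$, $\alpha$ and $r$) such that for every $\varepsilon\in(0,\varepsilon_0)$ there exists $r'>r$ with $|A_{\varepsilon,r'}|=|B_r|$, and for every such $r'$ $$-\infty<\lambda_1(A_{\varepsilon,r'})<\lambda_1(B_r).$$ -/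

import Mathlib

open MeasureTheory Set Filter Topology
open scoped ContDiff ENNReal

/-- The Euclidean space `ℝ^d`. -/
abbrev Euc (d : ℕ) : Type := EuclideanSpace ℝ (Fin d)

/-- The open ball `B_r` of radius `r` centred at the origin of `ℝ^d`. -/
def originBall (d : ℕ) (r : ℝ) : Set (Euc d) :=
  Metric.ball 0 r

/-- The annulus `A_{r₁,r₂}`: the open ball of radius `r₂` without the closed ball of radius `r₁`. -/
def annulus (d : ℕ) (r₁ r₂ : ℝ) : Set (Euc d) :=
  Metric.ball 0 r₂ \ Metric.closedBall 0 r₁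

/-- The surface measure on `∂Ω`: the `(d-1)`-dimensional Hausdorff measure, with the normalization
that agrees with Lebesgue measure on hyperplanes, restricted to the topological boundary. -/
noncomputable def boundaryMeasure {d : ℕ} (Ω : Set (Euc d)) : Measure (Euc d) :=
  (Measure.euclideanHausdorffMeasure (d - 1)).restrict (frontier Ω)

/-- `G` is the weak gradient of `u` on the open set `Ω`: `∫_Ω u ∂_v φ = - ∫_Ω φ ⟨G, v⟩` for every
test function `φ ∈ C_c^∞(Ω)` and every direction `v`. -/
def IsWeakGradient {d : ℕ} (Ω : Set (Euc d)) (u : Euc d → ℝ) (G : Euc d → Euc d) : Prop :=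
  ∀ φ : Euc d → ℝ, ContDiff ℝ ∞ φ → HasCompactSupport φ → tsupport φ ⊆ Ω →
    ∀ v : Euc d, ∫ x in Ω, u x * fderiv ℝ φ x v = - ∫ x in Ω, φ x * inner ℝ (G x) v

/-- `u ∈ H¹(Ω)` with weak gradient `G`. -/
structure IsSobolevH1 {d : ℕ} (Ω : Set (Euc d)) (u : Euc d → ℝ) (G : Euc d → Euc d) : Prop where
  memLp_fun : MemLp u 2 (volume.restrict Ω)
  memLp_grad : MemLp G 2 (volume.restrict Ω)
  isWeakGradient : IsWeakGradient Ω u G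

/-- `g ∈ L²(∂Ω)` is the boundary trace of the function `u ∈ H¹(Ω)` with weak gradient `G`: there are
functions, smooth up to the boundary, that converge to `u` in `H¹(Ω)` and to `g` in `L²(∂Ω)`.
(For a bounded Lipschitz open set every `u ∈ H¹(Ω)` has exactly one trace, by the density of smooth
functions and the trace inequality.) -/
def IsTrace {d : ℕ} (Ω : Set (Euc d)) (u : Euc d → ℝ) (G : Euc d → Euc d) (g : Euc d → ℝ) : Prop :=
  MemLp g 2 (boundaryMeasure Ω) ∧
  ∃ ψ : ℕ → Euc d → ℝ, (∀ k, ContDiff ℝ ∞ (ψ k)) ∧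
    Tendsto (fun k => eLpNorm (fun x => ψ k x - u x) 2 (volume.restrict Ω)) atTop (𝓝 0) ∧
    Tendsto (fun k => eLpNorm (fun x => gradient (ψ k) x - G x) 2 (volume.restrict Ω))
      atTop (𝓝 0) ∧
    Tendsto (fun k => eLpNorm (fun x => ψ k x - g x) 2 (boundaryMeasure Ω)) atTop (𝓝 0)

/-- The values of the Rayleigh quotient
`(∫_Ω |∇u|² dx - α ∫_{∂Ω} u² dσ) / ∫_Ω u² dx` over `u ∈ H¹(Ω) \ {0}`. -/
def robinRayleighValues {d : ℕ} (α : ℝ) (Ω : Set (Euc d)) : Set ℝ :=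
  {q | ∃ (u : Euc d → ℝ) (G : Euc d → Euc d) (g : Euc d → ℝ),
    IsSobolevH1 Ω u G ∧ IsTrace Ω u G g ∧ ¬ (u =ᵐ[volume.restrict Ω] 0) ∧
    q = ((∫ x in Ω, ‖G x‖ ^ 2) - α * ∫ x, g x ^ 2 ∂(boundaryMeasure Ω)) / ∫ x in Ω, u x ^ 2}

/-- The first eigenvalue `λ₁(Ω)` of `-Δu = λu` in `Ω`, `∂u/∂ν = αu` on `∂Ω`: the infimum of the
Rayleigh quotient over `H¹(Ω) \ {0}`. -/
noncomputable def robinFirstEigenvalue {d : ℕ} (α : ℝ) (Ω : Set (Euc d)) : ℝ :=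
  sInf (robinRayleighValues α Ω)

/-! Write n = d - 1. There are μ > 0 and a positive radial function f(‖x‖), smooth on all of ℝ^d,
with Δu = μu and f'(r) = βf(r); it is the ground state of the ball. Two facts carry the theorem.

Lower bound on the ball. P = sⁿf'/f solves the Riccati equation P² + sⁿP' = μs²ⁿ. Integrating (Pw²)'
along each ray and completing a square gives α∫_∂B ψ² ≤ ∫_B (|∇ψ|² + μψ²) for smooth ψ
(`ball_trace_inequality`). By density λ₁(B_r) ≥ -μ; equality is not needed.

Upper bound on the annulus with radii a < b. With f(‖x‖) as test function the energy ∫(|∇u|² + μu²)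
is a difference of boundary fluxes, so λ₁ < -μ follows once bⁿf'(b)f(b) - aⁿf'(a)f(a) < β(bⁿf(b)² +
aⁿf(a)²). The outer defect bⁿf(b)(f'(b) - βf(b)) vanishes at b = r, hence is O(b - r), and equality
of volumes makes this O(aⁿ⁺¹). The hole contributes at least βaⁿ, since f ≥ 1. So a small hole wins
(`exists_forall_flux_lt`).

Surface integrals are reduced to the unit sphere by uniqueness of the rotation invariant measure.
This yields a factor c common to all radii, whose value is irrelevant: it is absorbed in β = αc. The
function f comes from an explicit power series in ‖x‖². -/

/-! ### Hausdorff measure on spheres -/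

section SphereMeasure

variable {E : Type*} [NormedAddCommGroup E] [InnerProductSpace ℝ E]

theorem finrank_orthogonal_singleton {n : ℕ} (hE : Module.finrank ℝ E = n + 1) {v : E}
    (hv : ‖v‖ = 1) : Module.finrank ℝ (ℝ ∙ v)ᗮ = n := by
  have : Fact (Module.finrank ℝ E = n + 1) := ⟨hE⟩
  exact Submodule.finrank_orthogonal_span_singleton (by rintro rfl; simp at hv)

variable [MeasurableSpace E] [BorelSpace E]

/-- A finite measure invariant under linear isometries gives the same mass to balls of equal radius
whose centres have equal norm. -/
theorem measure_closedBall_eq_of_invariant {κ : Measure E}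
    (hκ : ∀ e : E ≃ₗᵢ[ℝ] E, κ.map e = κ) {x y : E} (hxy : ‖x‖ = ‖y‖) (s : ℝ) :
    κ (Metric.closedBall x s) = κ (Metric.closedBall y s) := by
  -- For points of equal norm, the reflection in the hyperplane orthogonal to x - y carries x to y.
  set e : E ≃ₗᵢ[ℝ] E := (ℝ ∙ (x - y))ᗮ.reflection
  have hex : e x = y := Submodule.reflection_sub hxy
  conv_rhs => rw [← hκ e]
  rw [Measure.map_apply e.continuous.measurable Metric.isClosed_closedBall.measurableSet,
    ← hex, LinearIsometryEquiv.preimage_closedBall]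
  simp

variable [FiniteDimensional ℝ E]

/-- A measure on the unit sphere, invariant under linear isometries, that is absolutely continuous
with respect to another such measure is a multiple of it. -/
theorem eq_smul_of_invariant_of_absolutelyContinuous {κ τ : Measure E} [IsFiniteMeasure κ]
    [IsFiniteMeasure τ] (hτS : τ (Metric.sphere 0 1)ᶜ = 0)
    (hκ : ∀ e : E ≃ₗᵢ[ℝ] E, κ.map e = κ) (hτ : ∀ e : E ≃ₗᵢ[ℝ] E, τ.map e = τ)
    (hac : κ ≪ τ) (hτ0 : τ ≠ 0) : ∃ L : ℝ≥0∞, κ = L • τ := by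
  have h1 := Besicovitch.ae_tendsto_rnDeriv κ τ
  have h2 : ∀ᵐ x ∂τ, x ∈ Metric.sphere (0 : E) 1 := by
    rw [ae_iff]; exact hτS
  have : (ae τ).NeBot := ae_neBot.2 hτ0
  obtain ⟨x₀, h10, h20⟩ := (h1.and h2).exists
  refine ⟨κ.rnDeriv τ x₀, ?_⟩
  -- By Besicovitch differentiation the density is a.e. the limit of the ratios of masses of small
  -- balls; by invariance these ratios are the same at every point of the sphere.
  have h3 : κ.rnDeriv τ =ᵐ[τ] fun _ => κ.rnDeriv τ x₀ := by
    filter_upwards [h1, h2] with x hx1 hx2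
    have hn : ‖x‖ = ‖x₀‖ := by
      rw [mem_sphere_zero_iff_norm.1 hx2, mem_sphere_zero_iff_norm.1 h20]
    refine tendsto_nhds_unique hx1 (h10.congr fun s => ?_)
    rw [measure_closedBall_eq_of_invariant hκ hn, measure_closedBall_eq_of_invariant hτ hn]
  calc κ = τ.withDensity (κ.rnDeriv τ) := (Measure.withDensity_rnDeriv_eq _ _ hac).symm
    _ = τ.withDensity (fun _ => κ.rnDeriv τ x₀) := withDensity_congr_ae h3
    _ = _ := withDensity_const _

/-- Uniqueness of the rotation invariant measure on the unit sphere. -/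
theorem exists_eq_smul_of_invariant {κ ν : Measure E} [IsFiniteMeasure κ] [IsFiniteMeasure ν]
    (hκS : κ (Metric.sphere 0 1)ᶜ = 0) (hνS : ν (Metric.sphere 0 1)ᶜ = 0)
    (hκ : ∀ e : E ≃ₗᵢ[ℝ] E, κ.map e = κ) (hν : ∀ e : E ≃ₗᵢ[ℝ] E, ν.map e = ν)
    (hκ0 : κ ≠ 0) (hν0 : ν ≠ 0) : ∃ c : ℝ≥0∞, c ≠ 0 ∧ c ≠ ⊤ ∧ κ = c • ν := by
  -- Neither measure is known to dominate the other, so both are compared with their sum.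
  have hτ : ∀ e : E ≃ₗᵢ[ℝ] E, (κ + ν).map e = κ + ν := fun e => by
    rw [Measure.map_add _ _ e.continuous.measurable, hκ, hν]
  have hS : (κ + ν) (Metric.sphere 0 1)ᶜ = 0 := by simp [hκS, hνS]
  have h0 : κ + ν ≠ 0 := fun h => hκ0 (by
    rw [← Measure.measure_univ_eq_zero] at h ⊢
    rw [Measure.add_apply] at h
    exact (add_eq_zero.1 h).1)
  obtain ⟨L, hL⟩ := eq_smul_of_invariant_of_absolutelyContinuous hS hκ hτ
    (Measure.AbsolutelyContinuous.rfl.add_right ν) h0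
  obtain ⟨M, hM⟩ := eq_smul_of_invariant_of_absolutelyContinuous hS hν hτ
    (by rw [add_comm]; exact Measure.AbsolutelyContinuous.rfl.add_right κ) h0
  have hu : (κ + ν) univ ≠ 0 := fun h => h0 (Measure.measure_univ_eq_zero.1 h)
  have fin : ∀ {K : ℝ≥0∞} {ξ : Measure E} [IsFiniteMeasure ξ], ξ = K • (κ + ν) → K ≠ ⊤ := by
    intro K ξ _ h hK
    have := measure_ne_top ξ univ
    rw [h, hK, Measure.smul_apply, smul_eq_mul, ENNReal.top_mul hu] at this
    exact this rfl
  have nz : ∀ {K : ℝ≥0∞} {ξ : Measure E}, ξ ≠ 0 → ξ = K • (κ + ν) → K ≠ 0 := by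
    intro K ξ h0 h hK
    exact h0 (by rw [h, hK, zero_smul])
  refine ⟨L * M⁻¹, ?_, ?_, ?_⟩
  · exact mul_ne_zero (nz hκ0 hL) (ENNReal.inv_ne_zero.2 (fin hM))
  · exact ENNReal.mul_ne_top (fin hL) (ENNReal.inv_ne_top.2 (nz hν0 hM))
  · conv_rhs => rw [hM]
    rw [smul_smul, mul_assoc, ENNReal.inv_mul_cancel (nz hν0 hM) (fin hM), mul_one]
    exact hL

open scoped Pointwise in
/-- The measure `μ.toSphere` is invariant under linear isometries. -/
theorem map_toSphere_map_linearIsometryEquiv (e : E ≃ₗᵢ[ℝ] E) :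
    ((volume : Measure E).toSphere.map Subtype.val).map e =
      (volume : Measure E).toSphere.map Subtype.val := by
  ext s hs
  have he : Measurable e := e.continuous.measurable
  rw [Measure.map_apply he hs, Measure.map_apply measurable_subtype_coe (he hs),
    Measure.map_apply measurable_subtype_coe hs, Measure.toSphere_apply' _ (measurable_subtype_coe (he hs)),
    Measure.toSphere_apply' _ (measurable_subtype_coe hs)]
  congr 1
  -- `toSphere` measures a set by the volume of the cone over it; cones commute with linear
  -- isometries, which preserve volume.
  have key : Ioo (0 : ℝ) 1 • ((↑) '' ((↑) ⁻¹' (e ⁻¹' s) : Set (Metric.sphere (0 : E) 1)) : Set E) =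
      e ⁻¹' (Ioo (0 : ℝ) 1 • ((↑) '' ((↑) ⁻¹' s : Set (Metric.sphere (0 : E) 1)) : Set E)) := by
    ext x
    simp only [Set.mem_smul, mem_preimage, Subtype.image_preimage_coe, mem_inter_iff,
      mem_sphere_zero_iff_norm]
    constructor
    · rintro ⟨t, ht, y, ⟨hy1, hy2⟩, rfl⟩
      exact ⟨t, ht, e y, ⟨by simpa using hy1, hy2⟩, by simp⟩
    · rintro ⟨t, ht, y, ⟨hy1, hy2⟩, h⟩
      refine ⟨t, ht, e.symm y, ⟨by simpa using hy1, by simpa using hy2⟩, e.injective ?_⟩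
      simpa using h
  rw [key]
  exact (e.measurePreserving).measure_preimage_emb e.toHomeomorph.measurableEmbedding _

/-- The part of the unit sphere where `⟪v, x⟫ ≤ 0` has finite `n`-dimensional Hausdorff measure. -/
theorem euclideanHausdorffMeasure_hemisphere_lt_top {n : ℕ} (hE : Module.finrank ℝ E = n + 1)
    {v : E} (hv : ‖v‖ = 1) :
    (Measure.euclideanHausdorffMeasure n : Measure E)
      (Metric.sphere 0 1 ∩ {x | inner ℝ v x ≤ 0}) < ⊤ := by
  have hF := finrank_orthogonal_singleton hE hv
  set Φ : (ℝ ∙ v)ᗮ → E := fun w => stereoInvFunAux v (w : E)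
  have hΦ : ContDiff ℝ 1 Φ := contDiff_stereoInvFunAux.comp (ℝ ∙ v)ᗮ.subtypeL.contDiff
  -- Stereographic projection from v scales the orthogonal projection by 2 / (1 - ⟪v, x⟫), which is
  -- at most 2 on this hemisphere. The inverse map is C¹, hence Lipschitz on the ball of radius 2.
  have hsub : Metric.sphere 0 1 ∩ {x : E | inner ℝ v x ≤ 0} ⊆ Φ '' (Metric.closedBall 0 2) := by
    rintro x ⟨hx1, hx2⟩
    have hxv : ((⟨x, hx1⟩ : Metric.sphere (0 : E) 1) : E) ≠ v := by
      rintro rfl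
      have : inner ℝ x x = ‖x‖ ^ 2 := real_inner_self_eq_norm_sq x
      simp only [mem_ofPred_eq] at hx2
      rw [this, hv] at hx2
      norm_num at hx2
    have h := stereo_left_inv hv hxv
    refine ⟨stereoToFun v x, ?_, congrArg Subtype.val h⟩
    rw [mem_closedBall_zero_iff, stereoToFun_apply, norm_smul]
    have hx2' : inner ℝ v x ≤ 0 := hx2
    have h1 : ‖(2 / (1 - innerSL ℝ v x) : ℝ)‖ ≤ 2 := by
      rw [innerSL_apply_apply, Real.norm_eq_abs, abs_of_nonneg (by apply div_nonneg <;> linarith)]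
      rw [div_le_iff₀ (by linarith)]
      linarith
    have h2 : ‖(ℝ ∙ v)ᗮ.orthogonalProjectionOnto x‖ ≤ 1 := by
      refine (Submodule.norm_orthogonalProjectionOnto_apply_le _ x).trans ?_
      rw [mem_sphere_zero_iff_norm.1 hx1]
    calc _ ≤ (2 : ℝ) * 1 := by gcongr
      _ = 2 := by norm_num
  obtain ⟨K, hK⟩ := hΦ.contDiffOn.exists_lipschitzOnWith one_ne_zero (convex_closedBall 0 2)
    (isCompact_closedBall (0 : (ℝ ∙ v)ᗮ) 2)
  have hfin : (Measure.hausdorffMeasure n : Measure (ℝ ∙ v)ᗮ) (Metric.closedBall 0 2) < ⊤ := by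
    rw [← hF]
    exact (isCompact_closedBall _ _).measure_lt_top
  rw [Measure.euclideanHausdorffMeasure_def, Measure.smul_apply]
  refine ENNReal.mul_lt_top ENNReal.coe_lt_top ?_
  calc _ ≤ _ := measure_mono hsub
    _ ≤ _ := hK.hausdorffMeasure_image_le (Nat.cast_nonneg n)
    _ < ⊤ := ENNReal.mul_lt_top (by simp) hfin

/-- The hemispheres opposite to v and to -v cover the sphere. -/
theorem euclideanHausdorffMeasure_sphere_lt_top {n : ℕ} (hE : Module.finrank ℝ E = n + 1) :
    (Measure.euclideanHausdorffMeasure n : Measure E) (Metric.sphere 0 1) < ⊤ := by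
  have : Nontrivial E := Module.nontrivial_of_finrank_pos (R := ℝ) (by omega)
  obtain ⟨v, hv⟩ := exists_norm_eq E (zero_le_one (α := ℝ))
  have hsub : Metric.sphere (0 : E) 1 ⊆ (Metric.sphere 0 1 ∩ {x | inner ℝ v x ≤ 0}) ∪
      (Metric.sphere 0 1 ∩ {x | inner ℝ (-v) x ≤ 0}) := by
    intro x hx
    rcases le_total (inner ℝ v x) 0 with h | h
    · exact Or.inl ⟨hx, h⟩
    · exact Or.inr ⟨hx, by simpa using h⟩
  refine (measure_mono hsub).trans_lt ((measure_union_le _ _).trans_lt (ENNReal.add_lt_top.2 ⟨?_, ?_⟩))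
  · exact euclideanHausdorffMeasure_hemisphere_lt_top hE hv
  · exact euclideanHausdorffMeasure_hemisphere_lt_top hE (by simpa using hv)

/-- Orthogonal projection to a hyperplane does not increase Hausdorff measure, and the image of the
sphere contains the open unit ball of the hyperplane. -/
theorem euclideanHausdorffMeasure_sphere_ne_zero {n : ℕ} (hE : Module.finrank ℝ E = n + 1) :
    (Measure.euclideanHausdorffMeasure n : Measure E) (Metric.sphere 0 1) ≠ 0 := by
  have : Nontrivial E := Module.nontrivial_of_finrank_pos (R := ℝ) (by omega)
  obtain ⟨v, hv⟩ := exists_norm_eq E (zero_le_one (α := ℝ))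
  have hF := finrank_orthogonal_singleton hE hv
  set Q : E → (ℝ ∙ v)ᗮ := fun x => (ℝ ∙ v)ᗮ.orthogonalProjectionOnto x
  have hQ : LipschitzWith 1 Q := LipschitzWith.of_dist_le_mul fun x y => by
    rw [dist_eq_norm, dist_eq_norm, ← map_sub]
    simpa using Submodule.norm_orthogonalProjectionOnto_apply_le (ℝ ∙ v)ᗮ (x - y)
  have hsub : Metric.ball (0 : (ℝ ∙ v)ᗮ) 1 ⊆ Q '' Metric.sphere 0 1 := by
    intro w hw
    rw [mem_ball_zero_iff] at hw
    have hvw : inner ℝ (w : E) v = 0 := by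
      have := Submodule.mem_orthogonal_singleton_iff_inner_left.1 w.2
      exact this
    refine ⟨w + Real.sqrt (1 - ‖w‖ ^ 2) • v, ?_, ?_⟩
    · rw [mem_sphere_zero_iff_norm]
      have h1 : ‖(w : E) + Real.sqrt (1 - ‖w‖ ^ 2) • v‖ ^ 2 = 1 := by
        rw [norm_add_sq_real, inner_smul_right, hvw, norm_smul, hv, mul_one, Real.norm_eq_abs,
          sq_abs, Real.sq_sqrt (by nlinarith [norm_nonneg w])]
        simp
      have := norm_nonneg ((w : E) + Real.sqrt (1 - ‖w‖ ^ 2) • v)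
      nlinarith
    · simp only [Q, map_add, map_smul]
      have h1 : (ℝ ∙ v)ᗮ.orthogonalProjectionOnto v = 0 := by
        rw [Submodule.orthogonalProjectionOnto_eq_zero_iff]
        simp
      rw [h1, Submodule.orthogonalProjectionOnto_mem_subspace_eq_self]
      simp
  intro h0
  rw [Measure.euclideanHausdorffMeasure_def, Measure.smul_apply, ENNReal.smul_def, smul_eq_mul,
    mul_eq_zero] at h0
  rcases h0 with h0 | h0
  · exact Measure.addHaarScalarFactor_volume_hausdorffMeasure_ne_zero n (by exact_mod_cast h0)
  · have hpos : (Measure.hausdorffMeasure n : Measure (ℝ ∙ v)ᗮ) (Metric.ball 0 1) ≠ 0 := by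
      rw [← hF]
      exact (Metric.measure_ball_pos _ _ one_pos).ne'
    refine hpos (le_antisymm ?_ zero_le)
    calc _ ≤ _ := measure_mono hsub
      _ ≤ _ := hQ.hausdorffMeasure_image_le (Nat.cast_nonneg n) _
      _ = 0 := by rw [h0, mul_zero]

/-- The Hausdorff measure of the unit sphere is a multiple of the cone measure `toSphere`. -/
theorem exists_euclideanHausdorffMeasure_sphere_eq {n : ℕ} (hE : Module.finrank ℝ E = n + 1) :
    ∃ c : ℝ≥0∞, c ≠ 0 ∧ c ≠ ⊤ ∧
      (Measure.euclideanHausdorffMeasure n : Measure E).restrict (Metric.sphere 0 1) =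
        c • (volume : Measure E).toSphere.map Subtype.val := by
  have : Nontrivial E := Module.nontrivial_of_finrank_pos (R := ℝ) (by omega)
  have : IsFiniteMeasure
      ((Measure.euclideanHausdorffMeasure n : Measure E).restrict (Metric.sphere 0 1)) :=
    ⟨by simpa using euclideanHausdorffMeasure_sphere_lt_top hE⟩
  have hm : MeasurableSet (Metric.sphere (0 : E) 1) := Metric.isClosed_sphere.measurableSet
  refine exists_eq_smul_of_invariant ?_ ?_ ?_ map_toSphere_map_linearIsometryEquiv ?_ ?_
  · rw [Measure.restrict_apply hm.compl]; simp
  · rw [Measure.map_apply measurable_subtype_coe hm.compl]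
    convert measure_empty (μ := (volume : Measure E).toSphere)
    ext x; simp
  · intro e
    have he := e.toIsometryEquiv.measurePreserving_euclideanHausdorffMeasure n
    have h := he.restrict_preimage hm
    have hp : e.toIsometryEquiv ⁻¹' (Metric.sphere (0 : E) 1) = Metric.sphere 0 1 := by
      ext x; simp
    rw [hp] at h
    exact h.map_eq
  · intro h
    have := congrArg (fun κ : Measure E => κ univ) h
    exact euclideanHausdorffMeasure_sphere_ne_zero hE (by simpa using this)
  · intro h
    have := congrArg (fun κ : Measure E => κ univ) h
    simp only [Measure.map_apply measurable_subtype_coe MeasurableSet.univ, preimage_univ,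
      Measure.coe_zero, Pi.zero_apply, Measure.measure_univ_eq_zero] at this
    exact Measure.toSphere_ne_zero _ this

open scoped Pointwise in
/-- The Hausdorff measure of the sphere of radius `ρ` is the dilated cone measure, with the same
factor for all radii. -/
theorem exists_forall_euclideanHausdorffMeasure_sphere_eq {n : ℕ}
    (hE : Module.finrank ℝ E = n + 1) :
    ∃ c : ℝ≥0∞, c ≠ 0 ∧ c ≠ ⊤ ∧ ∀ ρ : ℝ, 0 < ρ →
      (Measure.euclideanHausdorffMeasure n : Measure E).restrict (Metric.sphere 0 ρ) =
        (c * ENNReal.ofReal (ρ ^ n)) •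
          (volume : Measure E).toSphere.map (fun w : Metric.sphere (0 : E) 1 => ρ • (w : E)) := by
  obtain ⟨c, hc0, hc1, hc⟩ := exists_euclideanHausdorffMeasure_sphere_eq hE
  refine ⟨c, hc0, hc1, fun ρ hρ => ?_⟩
  ext s hs
  have hmρ : Measurable (fun x : E => ρ • x) := measurable_const_smul ρ
  have hmS : Measurable (fun w : Metric.sphere (0 : E) 1 => ρ • (w : E)) :=
    hmρ.comp measurable_subtype_coe
  -- Everything is pulled back to the unit sphere; the dilation contributes ρⁿ, so c does not depend
  -- on ρ.
  have hset : s ∩ Metric.sphere 0 ρ = ρ • (((fun x : E => ρ • x) ⁻¹' s) ∩ Metric.sphere 0 1) := by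
    ext x
    rw [Set.mem_smul_set_iff_inv_smul_mem₀ hρ.ne']
    simp only [mem_inter_iff, mem_preimage, smul_inv_smul₀ hρ.ne', mem_sphere_zero_iff_norm,
      norm_smul, norm_inv, Real.norm_eq_abs, abs_of_pos hρ]
    rw [inv_mul_eq_one₀ hρ.ne', eq_comm (a := ρ)]
  have hc' := congrArg (fun κ : Measure E => κ ((fun x : E => ρ • x) ⁻¹' s)) hc
  simp only [Measure.restrict_apply (hmρ hs), Measure.smul_apply,
    Measure.map_apply measurable_subtype_coe (hmρ hs), smul_eq_mul] at hc'
  rw [Measure.restrict_apply hs, hset, Measure.euclideanHausdorffMeasure_smul₀ n hρ.ne', hc',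
    Measure.smul_apply, Measure.map_apply hmS hs, smul_eq_mul,
    ENNReal.smul_def, smul_eq_mul, ← mul_assoc, mul_comm c]
  congr 2
  rw [ENNReal.ofReal, Real.toNNReal_pow hρ.le]
  simp [Real.nnnorm_of_nonneg hρ.le, Real.toNNReal_of_nonneg hρ.le]

end SphereMeasure

/-! ### Gradients of C¹ functions -/

section Gradient

variable {E : Type*} [NormedAddCommGroup E] [InnerProductSpace ℝ E] [CompleteSpace E]

theorem continuous_gradient {ψ : E → ℝ} (hψ : ContDiff ℝ 1 ψ) : Continuous (gradient ψ) :=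
  (InnerProductSpace.toDual ℝ E).symm.continuous.comp (hψ.continuous_fderiv one_ne_zero)

theorem inner_gradient_eq_fderiv (ψ : E → ℝ) (x v : E) :
    inner ℝ (gradient ψ x) v = fderiv ℝ ψ x v := by
  rw [gradient, ← InnerProductSpace.toDual_apply_apply, LinearIsometryEquiv.apply_symm_apply]

end Gradient

/-! ### Polar coordinates and weighted trace inequalities -/

section Polar

variable {E : Type*} [NormedAddCommGroup E] [InnerProductSpace ℝ E] [FiniteDimensional ℝ E]
  [MeasurableSpace E] [BorelSpace E]

/-- Integration in polar coordinates. -/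
theorem integral_polar {n : ℕ} (hE : Module.finrank ℝ E = n + 1) {f : E → ℝ}
    (hf : Integrable f) :
    Integrable (fun w : Metric.sphere (0 : E) 1 => ∫ s in Ioi (0 : ℝ), s ^ n * f (s • (w : E)))
      (volume : Measure E).toSphere ∧
    ∫ x, f x = ∫ w : Metric.sphere (0 : E) 1, (∫ s in Ioi (0 : ℝ), s ^ n * f (s • (w : E)))
      ∂(volume : Measure E).toSphere := by
  have : Nontrivial E := Module.nontrivial_of_finrank_pos (R := ℝ) (by omega)
  have hmp := (volume : Measure E).measurePreserving_homeomorphUnitSphereProd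
  have hem := (homeomorphUnitSphereProd E).measurableEmbedding
  set g : Metric.sphere (0 : E) 1 × Ioi (0 : ℝ) → ℝ := fun p => f (p.2.1 • (p.1 : E)) with hg
  have hgf : (fun x : ({0}ᶜ : Set E) => f x) = g ∘ homeomorphUnitSphereProd E := by
    ext x
    have hx : ‖(x : E)‖ ≠ 0 := norm_ne_zero_iff.2 x.2
    simp [hg, smul_smul, hx]
  have hint : Integrable g
      ((volume : Measure E).toSphere.prod (Measure.volumeIoiPow (Module.finrank ℝ E - 1))) := by
    rw [← hmp.integrable_comp_emb hem, ← hgf]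
    have h := hf.integrableOn (s := ({0}ᶜ : Set E))
    rwa [integrableOn_iff_comap_subtypeVal (measurableSet_singleton _).compl] at h
  have hray : ∀ w : Metric.sphere (0 : E) 1,
      ∫ s : Ioi (0 : ℝ), g (w, s) ∂(Measure.volumeIoiPow (Module.finrank ℝ E - 1)) =
        ∫ s in Ioi (0 : ℝ), s ^ n * f (s • (w : E)) := by
    intro w
    simp only [Measure.volumeIoiPow, ENNReal.ofReal, hE, Nat.add_sub_cancel]
    rw [integral_withDensity_eq_integral_smul (measurable_subtype_coe.pow_const _).real_toNNReal,
      integral_subtype_comap measurableSet_Ioi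
        (fun a : ℝ => Real.toNNReal (a ^ n) • f (a • (w : E)))]
    refine setIntegral_congr_fun measurableSet_Ioi fun s hs => ?_
    have hs' : (0 : ℝ) < s := hs
    simp only [NNReal.smul_def, smul_eq_mul]
    rw [Real.coe_toNNReal _ (pow_nonneg hs'.le _)]
  refine ⟨?_, ?_⟩
  · simpa only [hray] using hint.integral_prod_left
  · calc ∫ x, f x = ∫ x : ({0}ᶜ : Set E), f x ∂(volume.comap Subtype.val) := by
          rw [integral_subtype_comap (measurableSet_singleton _).compl f,
            MeasureTheory.restrict_compl_singleton]
      _ = ∫ p, g p ∂((volume : Measure E).toSphere.prod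
            (Measure.volumeIoiPow (Module.finrank ℝ E - 1))) := by
          rw [← hmp.integral_comp hem, hgf]; rfl
      _ = _ := by
          rw [integral_prod _ hint]
          simp only [hray]

/-- Integration over a spherical shell in polar coordinates. -/
theorem setIntegral_shell {n : ℕ} (hE : Module.finrank ℝ E = n + 1) {f : E → ℝ} {a b : ℝ}
    (ha : 0 ≤ a) (hf : Continuous f) :
    Integrable (fun w : Metric.sphere (0 : E) 1 => ∫ s in Ioo a b, s ^ n * f (s • (w : E)))
      (volume : Measure E).toSphere ∧
    ∫ x in norm ⁻¹' Ioo a b, f x =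
      ∫ w : Metric.sphere (0 : E) 1, (∫ s in Ioo a b, s ^ n * f (s • (w : E)))
      ∂(volume : Measure E).toSphere := by
  have hm : MeasurableSet (norm ⁻¹' Ioo a b : Set E) := measurable_norm measurableSet_Ioo
  have hint : Integrable ((norm ⁻¹' Ioo a b).indicator f) := by
    rw [integrable_indicator_iff hm]
    refine (hf.continuousOn.integrableOn_compact (isCompact_closedBall 0 b)).mono_set fun x hx => ?_
    simpa using (show ‖x‖ < b from hx.2).le
  obtain ⟨h1, h2⟩ := integral_polar hE hint
  have hray : ∀ w : Metric.sphere (0 : E) 1,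
      ∫ s in Ioi (0 : ℝ), s ^ n * (norm ⁻¹' Ioo a b).indicator f (s • (w : E)) =
        ∫ s in Ioo a b, s ^ n * f (s • (w : E)) := by
    intro w
    rw [← integral_indicator measurableSet_Ioi, ← integral_indicator measurableSet_Ioo]
    congr 1
    ext s
    by_cases hs : 0 < s
    · have hn : ‖s • (w : E)‖ = s := by simp [norm_smul, abs_of_pos hs]
      by_cases hs' : s ∈ Ioo a b
      · rw [indicator_of_mem (show s ∈ Ioi 0 from hs), indicator_of_mem hs', indicator_of_mem]
        rwa [mem_preimage, hn]
      · rw [indicator_of_mem (show s ∈ Ioi 0 from hs), indicator_of_notMem hs',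
          indicator_of_notMem, mul_zero]
        rwa [mem_preimage, hn]
    · rw [indicator_of_notMem (show s ∉ Ioi 0 from hs), indicator_of_notMem]
      exact fun h => hs (ha.trans_lt h.1)
  simp only [hray] at h1 h2
  rw [integral_indicator hm] at h2
  exact ⟨h1, h2⟩

/-- A one-dimensional weighted trace inequality, obtained from a solution `P` of a Riccati
differential inequality. -/
theorem weighted_trace_inequality {n : ℕ} {a b C : ℝ} (ha : 0 ≤ a) (hab : a ≤ b)
    {P P' w w' : ℝ → ℝ} (hP : ∀ s ∈ Icc a b, HasDerivAt P (P' s) s)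
    (hP' : ContinuousOn P' (Icc a b)) (hw : ∀ s, HasDerivAt w (w' s) s) (hw' : Continuous w')
    (hC : ∀ s ∈ Ioo a b, P s ^ 2 + P' s * s ^ n ≤ C * s ^ n * s ^ n) :
    P b * w b ^ 2 - P a * w a ^ 2 ≤ ∫ s in Ioo a b, s ^ n * (w' s ^ 2 + C * w s ^ 2) := by
  have hwc : Continuous w := continuous_iff_continuousAt.2 fun s => (hw s).continuousAt
  have hPc : ContinuousOn P (Icc a b) := fun s hs => (hP s hs).continuousAt.continuousWithinAt
  have hderiv : ∀ s ∈ uIcc a b, HasDerivAt (fun s => P s * w s ^ 2)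
      (P' s * w s ^ 2 + P s * (2 * w s * w' s)) s := by
    intro s hs
    rw [uIcc_of_le hab] at hs
    refine ((hP s hs).mul ((hw s).pow 2)).congr_deriv ?_
    simp
  have hcont : ContinuousOn (fun s => P' s * w s ^ 2 + P s * (2 * w s * w' s)) (Icc a b) := by
    fun_prop
  have hcont2 : Continuous (fun s => s ^ n * (w' s ^ 2 + C * w s ^ 2)) := by fun_prop
  have hI : IntervalIntegrable (fun s => P' s * w s ^ 2 + P s * (2 * w s * w' s)) volume a b := by
    rw [← uIcc_of_le hab] at hcont
    exact hcont.intervalIntegrable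
  rw [← intervalIntegral.integral_eq_sub_of_hasDerivAt hderiv hI,
    intervalIntegral.integral_of_le hab, integral_Ioc_eq_integral_Ioo]
  refine setIntegral_mono_on ((intervalIntegrable_iff_integrableOn_Ioo_of_le hab).1 hI)
    ((intervalIntegrable_iff_integrableOn_Ioo_of_le hab).1 (hcont2.intervalIntegrable a b))
    measurableSet_Ioo fun s hs => ?_
  have hs0 : 0 < s := ha.trans_lt hs.1
  have hsn : 0 < s ^ n := pow_pos hs0 n
  have h1 := hC s hs
  -- After multiplication by sⁿ the difference of the integrands is the square (sⁿw' - Pw)² plus w²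
  -- times the slack in the Riccati inequality.
  have h2 : 0 ≤ s ^ n * (s ^ n * (w' s ^ 2 + C * w s ^ 2) -
      (P' s * w s ^ 2 + P s * (2 * w s * w' s))) := by
    have : s ^ n * (s ^ n * (w' s ^ 2 + C * w s ^ 2) -
      (P' s * w s ^ 2 + P s * (2 * w s * w' s))) = (s ^ n * w' s - P s * w s) ^ 2 +
        w s ^ 2 * (C * s ^ n * s ^ n - (P s ^ 2 + P' s * s ^ n)) := by ring
    rw [this]
    exact add_nonneg (sq_nonneg _) (mul_nonneg (sq_nonneg _) (sub_nonneg.2 h1))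
  linarith [nonneg_of_mul_nonneg_right h2 hsn]

/-- The weighted trace inequality on a spherical shell. -/
theorem shell_trace_inequality {n : ℕ} (hE : Module.finrank ℝ E = n + 1) {a b C : ℝ} (ha : 0 ≤ a)
    (hab : a ≤ b) {P P' : ℝ → ℝ} (hP : ∀ s ∈ Icc a b, HasDerivAt P (P' s) s)
    (hP' : ContinuousOn P' (Icc a b))
    (hC : ∀ s ∈ Ioo a b, P s ^ 2 + P' s * s ^ n ≤ C * s ^ n * s ^ n)
    {ψ : E → ℝ} (hψ : ContDiff ℝ 1 ψ) :
    P b * ∫ w : Metric.sphere (0 : E) 1, ψ (b • (w : E)) ^ 2 ∂(volume : Measure E).toSphere -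
      P a * ∫ w : Metric.sphere (0 : E) 1, ψ (a • (w : E)) ^ 2 ∂(volume : Measure E).toSphere ≤
    ∫ x in norm ⁻¹' Ioo a b, (‖gradient ψ x‖ ^ 2 + C * ψ x ^ 2) := by
  have hψc := hψ.continuous
  have hgc := continuous_gradient hψ
  obtain ⟨h1, h2⟩ := setIntegral_shell hE (a := a) (b := b) ha
    (show Continuous fun x => ‖gradient ψ x‖ ^ 2 + C * ψ x ^ 2 by fun_prop)
  have hi : ∀ t : ℝ, Integrable (fun w : Metric.sphere (0 : E) 1 => ψ (t • (w : E)) ^ 2)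
      (volume : Measure E).toSphere := fun t =>
    (show Continuous fun w : Metric.sphere (0 : E) 1 => ψ (t • (w : E)) ^ 2 by
      fun_prop).integrable_of_hasCompactSupport (HasCompactSupport.of_compactSpace _)
  rw [h2, ← integral_const_mul, ← integral_const_mul, ← integral_sub ((hi b).const_mul _)
    ((hi a).const_mul _)]
  refine integral_mono (((hi b).const_mul _).sub ((hi a).const_mul _)) h1 fun w => ?_
  have hwn : ‖(w : E)‖ = 1 := by simp
  have hd : ∀ s : ℝ, HasDerivAt (fun s : ℝ => ψ (s • (w : E)))
      (inner ℝ (gradient ψ (s • (w : E))) (w : E)) s := by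
    intro s
    rw [inner_gradient_eq_fderiv]
    have h3 : HasDerivAt (fun s : ℝ => s • (w : E)) (w : E) s := by
      simpa using (hasDerivAt_id s).smul_const (w : E)
    exact ((hψ.differentiable one_ne_zero _).hasFDerivAt).comp_hasDerivAt s h3
  have hdc : Continuous fun s : ℝ => inner ℝ (gradient ψ (s • (w : E))) (w : E) := by fun_prop
  refine (weighted_trace_inequality ha hab hP hP' hd hdc hC).trans ?_
  have hii : ∀ g : ℝ → ℝ, Continuous g → IntegrableOn g (Ioo a b) := fun g hg =>
    (intervalIntegrable_iff_integrableOn_Ioo_of_le hab).1 (hg.intervalIntegrable a b)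
  refine setIntegral_mono_on (hii _ (by fun_prop)) (hii _ (by fun_prop)) measurableSet_Ioo
    fun s hs => ?_
  have hs0 : 0 < s := ha.trans_lt hs.1
  -- Only the radial derivative enters along a ray; the tangential part of the gradient is
  -- discarded.
  have h4 : inner ℝ (gradient ψ (s • (w : E))) (w : E) ^ 2 ≤ ‖gradient ψ (s • (w : E))‖ ^ 2 := by
    have := abs_real_inner_le_norm (gradient ψ (s • (w : E))) (w : E)
    rw [hwn, mul_one] at this
    exact sq_le_sq' (neg_le_of_abs_le this) (le_of_abs_le this)
  gcongr

end Polar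

/-! ### Boundary integrals over balls and annuli -/

section BoundaryMeasure

variable {n : ℕ}

/-- Dropping the null set {0} makes the ball a shell of inner radius 0, so that the shell formulas
apply to it. -/
theorem originBall_ae_eq (r : ℝ) :
    originBall (n + 1) r =ᵐ[volume] (norm ⁻¹' Ioo 0 r : Set (Euc (n + 1))) := by
  have h : originBall (n + 1) r \ {0} = (norm ⁻¹' Ioo 0 r : Set (Euc (n + 1))) := by
    ext x
    simp [originBall, and_comm]
  rw [← h]
  exact (sdiff_null_ae_eq_self (measure_singleton _)).symm

theorem annulus_eq (a b : ℝ) : annulus (n + 1) a b = norm ⁻¹' Ioo a b := by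
  ext x
  simp [annulus, and_comm]

theorem frontier_originBall {r : ℝ} (hr : 0 < r) :
    frontier (originBall (n + 1) r) = Metric.sphere 0 r :=
  frontier_ball _ hr.ne'

theorem frontier_annulus {a b : ℝ} (ha : 0 < a) (hab : a < b) :
    frontier (annulus (n + 1) a b) = Metric.sphere 0 b ∪ Metric.sphere 0 a := by
  have hb : 0 < b := ha.trans hab
  have hU : IsOpen (Metric.closedBall (0 : Euc (n + 1)) a)ᶜ := Metric.isClosed_closedBall.isOpen_compl
  have hV : IsOpen (Metric.ball (0 : Euc (n + 1)) b) := Metric.isOpen_ball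
  have hopen : IsOpen (annulus (n + 1) a b) := by
    rw [annulus, Set.sdiff_eq]; exact hV.inter hU
  have hcU : closure (Metric.closedBall (0 : Euc (n + 1)) a)ᶜ = (Metric.ball 0 a)ᶜ := by
    rw [closure_compl, interior_closedBall _ ha.ne']
  have hcV : closure (Metric.ball (0 : Euc (n + 1)) b) = Metric.closedBall 0 b :=
    closure_ball _ hb.ne'
  rw [hopen.frontier_eq]
  have hcl : closure (annulus (n + 1) a b) ⊆ Metric.closedBall 0 b ∩ (Metric.ball 0 a)ᶜ := by
    rw [annulus, Set.sdiff_eq, ← hcV, ← hcU]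
    exact closure_inter_subset_inter_closure _ _
  ext x
  simp only [Set.mem_sdiff, mem_union, mem_sphere_zero_iff_norm]
  constructor
  · rintro ⟨h1, h2⟩
    have h3 := hcl h1
    simp only [annulus, Set.mem_sdiff, mem_inter_iff, mem_compl_iff, mem_ball_zero_iff,
      mem_closedBall_zero_iff, not_lt, not_le, not_and] at h2 h3
    rcases h3.1.lt_or_eq with h | h
    · exact Or.inr (le_antisymm (h2 h) h3.2)
    · exact Or.inl h
  · rintro (h | h)
    · refine ⟨?_, by simp [annulus, h]⟩
      -- For open U, the set U ∩ closure V lies in closure (U ∩ V); here U is the exterior of the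
      -- hole.
      have : x ∈ (Metric.closedBall (0 : Euc (n + 1)) a)ᶜ ∩ closure (Metric.ball 0 b) := by
        rw [hcV]; simp [h, hab]
      have := hU.inter_closure this
      rwa [inter_comm, ← Set.sdiff_eq] at this
    · refine ⟨?_, by simp [annulus, h]⟩
      have : x ∈ Metric.ball (0 : Euc (n + 1)) b ∩ closure (Metric.closedBall 0 a)ᶜ := by
        rw [hcU]; simp [h, hab]
      have := hV.inter_closure this
      rwa [← Set.sdiff_eq] at this

/-- The boundary integrals over the ball and the annulus, up to one common dimensional factor, are
integrals over the unit sphere. -/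
theorem exists_integral_boundaryMeasure (n : ℕ) :
    ∃ c : ℝ, 0 < c ∧
      (∀ r : ℝ, 0 < r → IsFiniteMeasure (boundaryMeasure (originBall (n + 1) r)) ∧
        ∀ g : Euc (n + 1) → ℝ, Continuous g → ∫ x, g x ∂(boundaryMeasure (originBall (n + 1) r)) =
          c * r ^ n * ∫ w : Metric.sphere (0 : Euc (n + 1)) 1, g (r • (w : Euc (n + 1)))
            ∂(volume : Measure (Euc (n + 1))).toSphere) ∧
      (∀ a b : ℝ, 0 < a → a < b → IsFiniteMeasure (boundaryMeasure (annulus (n + 1) a b)) ∧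
        ∀ g : Euc (n + 1) → ℝ, Continuous g → ∫ x, g x ∂(boundaryMeasure (annulus (n + 1) a b)) =
          c * b ^ n * ∫ w : Metric.sphere (0 : Euc (n + 1)) 1, g (b • (w : Euc (n + 1)))
            ∂(volume : Measure (Euc (n + 1))).toSphere +
          c * a ^ n * ∫ w : Metric.sphere (0 : Euc (n + 1)) 1, g (a • (w : Euc (n + 1)))
            ∂(volume : Measure (Euc (n + 1))).toSphere) := by
  have hE : Module.finrank ℝ (Euc (n + 1)) = n + 1 := by simp
  obtain ⟨c, hc0, hc1, hc⟩ := exists_forall_euclideanHausdorffMeasure_sphere_eq hE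
  set ν : ℝ → Measure (Euc (n + 1)) := fun r =>
    (Measure.euclideanHausdorffMeasure n : Measure (Euc (n + 1))).restrict (Metric.sphere 0 r)
  have hmeas : ∀ ρ : ℝ, Measurable
      (fun w : Metric.sphere (0 : Euc (n + 1)) 1 => ρ • (w : Euc (n + 1))) := fun ρ =>
    measurable_subtype_coe.const_smul ρ
  have hfin : ∀ r, 0 < r → IsFiniteMeasure (ν r) := fun r hr => by
    constructor
    simp only [ν, hc r hr, Measure.smul_apply, smul_eq_mul]
    exact ENNReal.mul_lt_top (ENNReal.mul_lt_top hc1.lt_top ENNReal.ofReal_lt_top)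
      (measure_lt_top _ _)
  have hint : ∀ r, 0 < r → ∀ g : Euc (n + 1) → ℝ, Continuous g → ∫ x, g x ∂(ν r) =
      c.toReal * r ^ n * ∫ w : Metric.sphere (0 : Euc (n + 1)) 1, g (r • (w : Euc (n + 1)))
        ∂(volume : Measure (Euc (n + 1))).toSphere := fun r hr g hg => by
    simp only [ν, hc r hr]
    rw [integral_smul_measure, integral_map (hmeas r).aemeasurable hg.aestronglyMeasurable,
      ENNReal.toReal_mul, ENNReal.toReal_ofReal (by positivity), smul_eq_mul]
  have hball : ∀ r, 0 < r → boundaryMeasure (originBall (n + 1) r) = ν r := fun r hr => by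
    rw [boundaryMeasure, frontier_originBall hr]; rfl
  have hann : ∀ a b, 0 < a → a < b → boundaryMeasure (annulus (n + 1) a b) = ν b + ν a :=
    fun a b ha hab => by
      rw [boundaryMeasure, frontier_annulus ha hab, Measure.restrict_union ?_
        Metric.isClosed_sphere.measurableSet]
      · rfl
      · refine Set.disjoint_left.2 fun x h1 h2 => hab.ne ?_
        rw [← mem_sphere_zero_iff_norm.1 h1, ← mem_sphere_zero_iff_norm.1 h2]
  refine ⟨c.toReal, ENNReal.toReal_pos hc0 hc1, fun r hr => ?_, fun a b ha hab => ?_⟩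
  · rw [hball r hr]
    exact ⟨hfin r hr, hint r hr⟩
  · have hb := ha.trans hab
    have i1 := hfin a ha
    have i2 := hfin b hb
    rw [hann a b ha hab]
    refine ⟨inferInstance, fun g hg => ?_⟩
    have hgi : ∀ r, 0 < r → Integrable g (ν r) := fun r hr =>
      hg.continuousOn.integrableOn_of_subset_isCompact (isCompact_sphere 0 r)
        Metric.isClosed_sphere.measurableSet Subset.rfl (by
          have := (hfin r hr).measure_univ_lt_top
          simpa [ν] using this.ne)
    rw [integral_add_measure (hgi b hb) (hgi a ha), hint b hb g hg, hint a ha g hg]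

end BoundaryMeasure

/-! ### The power series of the radial solution -/

section EntireSeries

/-- Sum of the power series with coefficients `c`. -/
noncomputable def powerSum (c : ℕ → ℝ) (t : ℝ) : ℝ := ∑' k, c k * t ^ k

/-- Coefficients of the derivative of a power series. -/
def derivCoeff (c : ℕ → ℝ) (k : ℕ) : ℝ := (k + 1) * c (k + 1)

variable {c : ℕ → ℝ} {M : ℝ}

/-- The factorial bound survives differentiation with the same M, so smoothness follows by induction
on the order. -/
theorem abs_derivCoeff_le (hc : ∀ k, |c k| ≤ M / (k.factorial : ℝ)) (k : ℕ) :
    |derivCoeff c k| ≤ M / (k.factorial : ℝ) := by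
  have h := hc (k + 1)
  have hk : (0 : ℝ) < k + 1 := by positivity
  have hf : (0 : ℝ) < (k.factorial : ℝ) := by positivity
  rw [derivCoeff, abs_mul, abs_of_pos hk]
  calc ((k : ℝ) + 1) * |c (k + 1)| ≤ (k + 1) * (M / ((k + 1).factorial : ℝ)) := by gcongr
    _ = M / (k.factorial : ℝ) := by
      rw [Nat.factorial_succ]; push_cast; field_simp

theorem summable_powerSum (hc : ∀ k, |c k| ≤ M / (k.factorial : ℝ)) (t : ℝ) :
    Summable fun k => c k * t ^ k := by
  refine Summable.of_norm_bounded ((Real.summable_pow_div_factorial |t|).mul_left M) fun k => ?_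
  rw [norm_mul, norm_pow, Real.norm_eq_abs, Real.norm_eq_abs]
  calc |c k| * |t| ^ k ≤ M / (k.factorial : ℝ) * |t| ^ k := by gcongr; exact hc k
    _ = _ := by ring

theorem hasDerivAt_powerSum (hc : ∀ k, |c k| ≤ M / (k.factorial : ℝ)) (t : ℝ) :
    HasDerivAt (powerSum c) (powerSum (derivCoeff c) t) t := by
  set R : ℝ := |t| + 1
  have hsum : Summable fun k : ℕ => |(k : ℝ) * c k| * R ^ (k - 1) := by
    rw [← summable_nat_add_iff 1]
    have hc' : ∀ k, |(|derivCoeff c k|)| ≤ M / (k.factorial : ℝ) := fun k => by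
      rw [abs_abs]; exact abs_derivCoeff_le hc k
    refine (summable_powerSum hc' R).congr fun k => ?_
    simp [derivCoeff]
  have hd := hasDerivAt_tsum_of_isPreconnected (t := Metric.ball (0 : ℝ) R) (y₀ := 0) (y := t)
    (g := fun k t => c k * t ^ k) (g' := fun k t => c k * (k * t ^ (k - 1))) hsum Metric.isOpen_ball
    (convex_ball 0 R).isPreconnected (fun k y _ => (hasDerivAt_pow k y).const_mul (c k)) ?_
    (by simp [R]; positivity) (summable_powerSum hc 0) (by simp [R])
  · refine HasDerivAt.congr_deriv (f := powerSum c) hd ?_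
    have hs : Summable fun k : ℕ => c k * (k * t ^ (k - 1)) := by
      rw [← summable_nat_add_iff 1]
      refine (summable_powerSum (abs_derivCoeff_le hc) t).congr fun k => ?_
      simp [derivCoeff]; ring
    rw [hs.tsum_eq_zero_add]
    simp only [powerSum, derivCoeff, CharP.cast_eq_zero, zero_mul, mul_zero, zero_add,
      Nat.add_sub_cancel, Nat.cast_add, Nat.cast_one]
    exact tsum_congr fun k => by ring
  · intro k y hy
    rw [norm_mul, norm_mul, norm_pow, ← mul_assoc, abs_mul, mul_comm |(k : ℝ)|]
    simp only [Real.norm_eq_abs]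
    have : |y| ≤ R := by simpa using (mem_ball_zero_iff.1 hy).le
    gcongr

theorem contDiff_powerSum (hc : ∀ k, |c k| ≤ M / (k.factorial : ℝ)) :
    ContDiff ℝ ∞ (powerSum c) := by
  rw [contDiff_infty]
  intro N
  induction N generalizing c with
  | zero =>
    exact contDiff_zero.2 (continuous_iff_continuousAt.2 fun t => (hasDerivAt_powerSum hc t).continuousAt)
  | succ N ih =>
    have hd : deriv (powerSum c) = powerSum (derivCoeff c) :=
      funext fun t => (hasDerivAt_powerSum hc t).deriv
    have := ih (abs_derivCoeff_le hc)
    push_cast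
    rw [contDiff_succ_iff_deriv, hd]
    exact ⟨fun t => (hasDerivAt_powerSum hc t).differentiableAt, by simp, this⟩

/-- Coefficients of the solution `F` of `4 t F'' + 2 (n + 1) F' = F`, `F 0 = 1`. -/
noncomputable def radialCoeff (n : ℕ) : ℕ → ℝ
  | 0 => 1
  | k + 1 => radialCoeff n k / (2 * (k + 1) * (2 * k + (n + 1)))

theorem radialCoeff_pos (n k : ℕ) : 0 < radialCoeff n k := by
  induction k with
  | zero => simp [radialCoeff]
  | succ k ih => rw [radialCoeff]; positivity

theorem abs_radialCoeff_le (n k : ℕ) : |radialCoeff n k| ≤ 1 / (k.factorial : ℝ) := by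
  rw [abs_of_pos (radialCoeff_pos n k)]
  induction k with
  | zero => simp [radialCoeff]
  | succ k ih =>
    rw [radialCoeff, Nat.factorial_succ]
    push_cast
    have h1 : (0 : ℝ) < k.factorial := by positivity
    have hn : (0 : ℝ) ≤ n := Nat.cast_nonneg n
    have hk : (0 : ℝ) ≤ k := Nat.cast_nonneg k
    have h2 : ((k : ℝ) + 1) ≤ 2 * (k + 1) * (2 * k + (n + 1)) := by nlinarith [mul_nonneg hk hn]
    calc _ ≤ (1 / (k.factorial : ℝ)) / (k + 1) := by gcongr
      _ = _ := by field_simp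

theorem le_powerSum {n : ℕ} {t : ℝ} (ht : 0 ≤ t) (k : ℕ) :
    radialCoeff n k * t ^ k ≤ powerSum (radialCoeff n) t :=
  (summable_powerSum (abs_radialCoeff_le n) t).le_tsum k fun j _ =>
    mul_nonneg (radialCoeff_pos n j).le (pow_nonneg ht j)

/-- With f(s) = F(μs²) this is the radial equation f'' + (n/s)f' = μf. Comparing coefficients,
4k(k+1) + 2(n+1)(k+1) = 2(k+1)(2k+n+1), the divisor in `radialCoeff`. -/
theorem radial_equation (n : ℕ) (t : ℝ) :
    4 * t * powerSum (derivCoeff (derivCoeff (radialCoeff n))) t +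
      2 * (n + 1) * powerSum (derivCoeff (radialCoeff n)) t = powerSum (radialCoeff n) t := by
  have h0 := abs_radialCoeff_le n
  have h1 := abs_derivCoeff_le h0
  have h2 := abs_derivCoeff_le h1
  have hs2 := (summable_powerSum h2 t).mul_left t
  have hs : Summable fun k : ℕ => (k * derivCoeff (radialCoeff n) k) * t ^ k := by
    rw [← summable_nat_add_iff 1]
    refine hs2.congr fun k => ?_
    rw [derivCoeff.eq_1 (derivCoeff (radialCoeff n))]; push_cast; ring
  have hshift : t * powerSum (derivCoeff (derivCoeff (radialCoeff n))) t =
      ∑' k : ℕ, (k * derivCoeff (radialCoeff n) k) * t ^ k := by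
    rw [hs.tsum_eq_zero_add, powerSum, ← tsum_mul_left]
    simp only [CharP.cast_eq_zero, zero_mul, zero_add]
    refine tsum_congr fun k => ?_
    rw [derivCoeff.eq_1 (derivCoeff (radialCoeff n))]; push_cast; ring
  rw [mul_assoc, hshift, powerSum, powerSum, ← tsum_mul_left, ← tsum_mul_left,
    ← (hs.mul_left 4).tsum_add ((summable_powerSum h1 t).mul_left _)]
  refine tsum_congr fun k => ?_
  have : (2 * ((k : ℝ) + 1) * (2 * k + (n + 1))) ≠ 0 := by positivity
  have h : (2 * ((k : ℝ) + 1) * (2 * k + (n + 1))) * radialCoeff n (k + 1) = radialCoeff n k := by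
    rw [radialCoeff]; field_simp
  rw [derivCoeff, ← h]
  ring

/-- The logarithmic derivative of the radial solution takes all positive values. -/
theorem exists_logDeriv_eq (n : ℕ) {K : ℝ} (hK : 0 < K) :
    ∃ t : ℝ, 0 < t ∧
      2 * t * powerSum (derivCoeff (radialCoeff n)) t = K * powerSum (radialCoeff n) t := by
  have h0 := abs_radialCoeff_le n
  have h1 := abs_derivCoeff_le h0
  set F := powerSum (radialCoeff n)
  set F1 := powerSum (derivCoeff (radialCoeff n))
  have hF : ∀ t, HasDerivAt F (F1 t) t := hasDerivAt_powerSum h0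
  have hFc : Continuous F := (contDiff_powerSum h0).continuous
  have hF1c : Continuous F1 := (contDiff_powerSum h1).continuous
  have hF0 : F 0 = 1 := by
    simp only [F, powerSum]
    rw [tsum_eq_single 0 fun k hk => by simp [hk]]
    simp [radialCoeff]
  -- Otherwise tF' ≤ NF with N ≥ K/2, so F/t^N is antitone on [1, ∞). But F dominates its own term
  -- of degree N + 1, whose coefficient is positive.
  obtain ⟨T, hT0, hT⟩ : ∃ T, 0 < T ∧ K * F T ≤ 2 * T * F1 T := by
    by_contra! hcon
    obtain ⟨N, hN⟩ := exists_nat_ge (K / 2)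
    have hd : ∀ t ∈ Ici (1 : ℝ), HasDerivAt (fun t => F t / t ^ N)
        ((F1 t * t ^ N - F t * (N * t ^ (N - 1))) / (t ^ N) ^ 2) t := fun t ht => by
      have ht0 : (0 : ℝ) < t := one_pos.trans_le ht
      exact (hF t).div (hasDerivAt_pow N t) (pow_pos ht0 N).ne'
    have hanti : AntitoneOn (fun t => F t / t ^ N) (Ici (1 : ℝ)) := by
      refine antitoneOn_of_deriv_nonpos (convex_Ici 1)
        (fun t ht => (hd t ht).continuousAt.continuousWithinAt)
        (fun t ht => (hd t (interior_subset ht)).differentiableAt.differentiableWithinAt) ?_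
      intro t ht
      rw [(hd t (interior_subset ht)).deriv]
      have ht1 : (1 : ℝ) ≤ t := interior_subset ht
      have ht0 : (0 : ℝ) < t := one_pos.trans_le ht1
      refine div_nonpos_of_nonpos_of_nonneg ?_ (by positivity)
      have hFt : 0 < F t := by
        have := le_powerSum (n := n) ht0.le 0
        simp only [radialCoeff, pow_zero, mul_one] at this
        exact one_pos.trans_le this
      have hc := hcon t ht0
      have h3 : t * F1 t ≤ N * F t := by nlinarith
      have h4 : F1 t * t ^ N - F t * (N * t ^ (N - 1)) = (t ^ N / t) * (t * F1 t - N * F t) := by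
        rcases N with _ | N
        · field_simp; simp
        · rw [Nat.add_sub_cancel]; field_simp; ring
      rw [h4]
      exact mul_nonpos_of_nonneg_of_nonpos (by positivity) (by linarith)
    have hcp := radialCoeff_pos n (N + 1)
    set t := max 1 (F 1 / radialCoeff n (N + 1) + 1)
    have ht1 : 1 ≤ t := le_max_left _ _
    have ht0 : 0 < t := one_pos.trans_le ht1
    have h5 := hanti (mem_Ici.2 le_rfl) (mem_Ici.2 ht1) ht1
    simp only [one_pow, div_one] at h5
    rw [div_le_iff₀ (pow_pos ht0 N)] at h5
    have h6 : radialCoeff n (N + 1) * t ^ (N + 1) ≤ F t := le_powerSum (n := n) ht0.le (N + 1)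
    have h7 : F 1 < radialCoeff n (N + 1) * t := by
      rw [mul_comm, ← div_lt_iff₀ hcp]
      exact (lt_add_one _).trans_le (le_max_right _ _)
    have h8 : F 1 * t ^ N < radialCoeff n (N + 1) * t * t ^ N :=
      mul_lt_mul_of_pos_right h7 (pow_pos ht0 N)
    have h9 : radialCoeff n (N + 1) * t ^ (N + 1) = radialCoeff n (N + 1) * t * t ^ N := by ring
    linarith
  -- The function is -K < 0 at t = 0 and nonnegative at T.
  have hivt := intermediate_value_Icc (f := fun t => 2 * t * F1 t - K * F t) hT0.le
    (by fun_prop : Continuous fun t => 2 * t * F1 t - K * F t).continuousOn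
  obtain ⟨t, ht, hteq⟩ := hivt (show (0 : ℝ) ∈ Icc _ _ by
    simp only [mul_zero, zero_mul, hF0, mem_Icc]; constructor <;> linarith)
  have hteq' : 2 * t * F1 t - K * F t = 0 := hteq
  refine ⟨t, lt_of_le_of_ne ht.1 ?_, by linarith⟩
  rintro rfl
  simp only [mul_zero, zero_mul, hF0] at hteq'
  linarith

end EntireSeries

/-! ### The radial ground state -/

/-- A positive radial solution `x ↦ f ‖x‖` of `Δ u = μ u` on the whole space whose logarithmic
derivative at radius `r` is `β`. -/
structure IsRadialGroundState (n : ℕ) (β r μ : ℝ) (f f' : ℝ → ℝ) : Prop where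
  contDiff : ContDiff ℝ ∞ fun x : Euc (n + 1) => f ‖x‖
  norm_gradient : ∀ x : Euc (n + 1), ‖gradient (fun x : Euc (n + 1) => f ‖x‖) x‖ = f' ‖x‖
  hasDerivAt : ∀ s, HasDerivAt f (f' s) s
  differentiable_deriv : Differentiable ℝ f'
  hasDerivAt_flux : ∀ s, HasDerivAt (fun s => s ^ n * f' s) (μ * s ^ n * f s) s
  one_le : ∀ s, 1 ≤ f s
  deriv_nonneg : ∀ s, 0 ≤ s → 0 ≤ f' s
  deriv_zero : f' 0 = 0
  deriv_eq : f' r = β * f r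

/-- Take f(s) = F(μs²) with μ = t₀/r², where 2t₀F'(t₀) = βrF(t₀); this is rf'(r) = βrf(r).
Dependence on ‖x‖² alone gives smoothness at the origin. -/
theorem exists_isRadialGroundState (n : ℕ) {β r : ℝ} (hβ : 0 < β) (hr : 0 < r) :
    ∃ μ : ℝ, 0 < μ ∧ ∃ f f' : ℝ → ℝ, IsRadialGroundState n β r μ f f' := by
  obtain ⟨t₀, ht₀, hroot⟩ := exists_logDeriv_eq n (mul_pos hβ hr)
  have h0 := abs_radialCoeff_le n
  have h1 := abs_derivCoeff_le h0
  have hode := radial_equation n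
  have hle : ∀ t, 0 ≤ t → 1 ≤ powerSum (radialCoeff n) t := fun t ht => by
    simpa [radialCoeff] using le_powerSum (n := n) ht 0
  have hF1nn : ∀ t, 0 ≤ t → 0 ≤ powerSum (derivCoeff (radialCoeff n)) t := fun t ht =>
    tsum_nonneg fun k => mul_nonneg (mul_nonneg (by positivity) (radialCoeff_pos n _).le)
      (pow_nonneg ht k)
  have hF := hasDerivAt_powerSum h0
  have hF1 := hasDerivAt_powerSum h1
  have hFs := contDiff_powerSum h0
  set F := powerSum (radialCoeff n)
  set F1 := powerSum (derivCoeff (radialCoeff n))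
  set F2 := powerSum (derivCoeff (derivCoeff (radialCoeff n)))
  have hμ : 0 < t₀ / r ^ 2 := by positivity
  have hμr : t₀ / r ^ 2 * r ^ 2 = t₀ := by field_simp
  set μ := t₀ / r ^ 2
  have hin : ∀ s : ℝ, HasDerivAt (fun s : ℝ => μ * s ^ 2) (μ * (2 * s)) s := fun s => by
    simpa using (hasDerivAt_pow 2 s).const_mul μ
  have hcomp1 : ∀ s, HasDerivAt (fun s => F1 (μ * s ^ 2)) (F2 (μ * s ^ 2) * (μ * (2 * s))) s :=
    fun s => (hF1 _).comp s (hin s)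
  refine ⟨μ, hμ, fun s => F (μ * s ^ 2), fun s => 2 * μ * s * F1 (μ * s ^ 2), ?_⟩
  refine ⟨hFs.comp (contDiff_const.mul (contDiff_norm_sq ℝ)), fun x => ?_, fun s => ?_, ?_,
    fun s => ?_, fun s => hle _ (by positivity), fun s hs => ?_, by simp, ?_⟩
  · have h3 : HasFDerivAt (fun x : Euc (n + 1) => F (μ * ‖x‖ ^ 2))
        (F1 (μ * ‖x‖ ^ 2) • μ • 2 • innerSL ℝ x) x :=
      HasDerivAt.comp_hasFDerivAt (h₂ := F) (f := fun x : Euc (n + 1) => μ * ‖x‖ ^ 2) x (hF _)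
        ((hasStrictFDerivAt_norm_sq x).hasFDerivAt.const_mul μ)
    rw [gradient, LinearIsometryEquiv.norm_map, h3.fderiv, norm_smul, norm_smul, ← Nat.cast_smul_eq_nsmul ℝ,
      norm_smul, innerSL_apply_norm, Real.norm_of_nonneg (hF1nn _ (by positivity)),
      Real.norm_of_nonneg hμ.le]
    simp
    ring
  · refine ((hF _).comp s (hin s)).congr_deriv ?_
    ring
  · exact fun s => ((hasDerivAt_id s).const_mul (2 * μ)).differentiableAt.mul
      (hcomp1 s).differentiableAt
  · have h4 : HasDerivAt (fun s => 2 * μ * s ^ (n + 1) * F1 (μ * s ^ 2)) _ s :=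
      ((hasDerivAt_pow (n + 1) s).const_mul (2 * μ)).mul (hcomp1 s)
    refine (h4.congr_of_eventuallyEq (Eventually.of_forall fun s => ?_)).congr_deriv ?_
    · ring
    · rw [← hode]
      push_cast
      ring
  · exact mul_nonneg (by positivity) (hF1nn _ (by positivity))
  · rw [hμr]
    have : 2 * μ * r * F1 t₀ * r = 2 * t₀ * F1 t₀ := by rw [← hμr]; ring
    rw [hroot] at this
    refine mul_right_cancel₀ hr.ne' ?_
    rw [this]; ring

/-! ### Square integrals and L² convergence -/

section SquareIntegrable

variable {X : Type*} [MeasurableSpace X] {ν : Measure X}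

theorem norm_toLp_sq_eq_integral {H : Type*} [NormedAddCommGroup H] [InnerProductSpace ℝ H]
    {f : X → H} (hf : MemLp f 2 ν) : ‖hf.toLp f‖ ^ 2 = ∫ x, ‖f x‖ ^ 2 ∂ν := by
  rw [← real_inner_self_eq_norm_sq, L2.inner_def]
  refine integral_congr_ae ?_
  filter_upwards [hf.coeFn_toLp] with x hx
  rw [hx, real_inner_self_eq_norm_sq]

theorem tendsto_integral_norm_sq {H : Type*} [NormedAddCommGroup H] [InnerProductSpace ℝ H]
    {f : ℕ → X → H} {g : X → H} (hf : ∀ k, MemLp (f k) 2 ν) (hg : MemLp g 2 ν)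
    (h : Tendsto (fun k => eLpNorm (fun x => f k x - g x) 2 ν) atTop (𝓝 0)) :
    Tendsto (fun k => ∫ x, ‖f k x‖ ^ 2 ∂ν) atTop (𝓝 (∫ x, ‖g x‖ ^ 2 ∂ν)) := by
  have h1 := ((Lp.tendsto_Lp_iff_tendsto_eLpNorm'' f hf g hg).2 h).norm.pow 2
  rw [norm_toLp_sq_eq_integral hg] at h1
  exact h1.congr fun k => norm_toLp_sq_eq_integral (hf k)

theorem memLp_of_continuous_of_ae_mem_isCompact {E H : Type*} [TopologicalSpace E]
    [MeasurableSpace E] [OpensMeasurableSpace E] [NormedAddCommGroup H]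
    [SecondCountableTopologyEither E H] {κ : Measure E} [IsFiniteMeasure κ] {K : Set E}
    (hK : IsCompact K) (hκ : ∀ᵐ x ∂κ, x ∈ K) {f : E → H} (hf : Continuous f) (p : ℝ≥0∞) :
    MemLp f p κ := by
  obtain ⟨C, hC⟩ := hK.exists_bound_of_continuousOn hf.continuousOn
  exact MemLp.of_bound hf.aestronglyMeasurable C (hκ.mono hC)

end SquareIntegrable

/-! ### Bounds for the Rayleigh quotient -/

section RayleighQuotient

variable {d : ℕ} {Ω : Set (Euc d)}

theorem memLp_restrict_of_continuous {H : Type*} [NormedAddCommGroup H] (hΩ : IsOpen Ω)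
    (hb : Bornology.IsBounded Ω) {f : Euc d → H} (hf : Continuous f) :
    MemLp f 2 (volume.restrict Ω) := by
  have : IsFiniteMeasure (volume.restrict Ω) := ⟨by simpa using hb.measure_lt_top⟩
  exact memLp_of_continuous_of_ae_mem_isCompact hb.isCompact_closure
    ((ae_restrict_mem hΩ.measurableSet).mono fun _ hx => subset_closure hx) hf 2

theorem memLp_boundaryMeasure_of_continuous (hb : Bornology.IsBounded Ω)
    [IsFiniteMeasure (boundaryMeasure Ω)] {f : Euc d → ℝ} (hf : Continuous f) :
    MemLp f 2 (boundaryMeasure Ω) :=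
  memLp_of_continuous_of_ae_mem_isCompact (κ := boundaryMeasure Ω)
    (hb.isCompact_closure.of_isClosed_subset isClosed_frontier frontier_subset_closure)
    (ae_restrict_mem isClosed_frontier.measurableSet) hf 2

/-- An inequality for smooth functions bounds the Rayleigh quotient on `H¹(Ω)` from below. -/
theorem neg_le_of_mem_robinRayleighValues (hΩ : IsOpen Ω) (hb : Bornology.IsBounded Ω)
    [IsFiniteMeasure (boundaryMeasure Ω)] {α C : ℝ}
    (hC : ∀ ψ : Euc d → ℝ, ContDiff ℝ ∞ ψ → α * ∫ x, ψ x ^ 2 ∂(boundaryMeasure Ω) ≤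
      ∫ x in Ω, (‖gradient ψ x‖ ^ 2 + C * ψ x ^ 2)) {q : ℝ} (hq : q ∈ robinRayleighValues α Ω) :
    -C ≤ q := by
  obtain ⟨u, G, g, hu, ⟨hg, ψ, hψ, hψu, hψG, hψg⟩, hu0, rfl⟩ := hq
  have hψ1 : ∀ k, ContDiff ℝ 1 (ψ k) := fun k => (hψ k).of_le (by exact_mod_cast le_top)
  have hm1 : ∀ k, MemLp (ψ k) 2 (volume.restrict Ω) := fun k =>
    memLp_restrict_of_continuous hΩ hb (hψ k).continuous
  have hm2 : ∀ k, MemLp (gradient (ψ k)) 2 (volume.restrict Ω) := fun k =>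
    memLp_restrict_of_continuous hΩ hb (continuous_gradient (hψ1 k))
  have hm3 : ∀ k, MemLp (ψ k) 2 (boundaryMeasure Ω) := fun k =>
    memLp_boundaryMeasure_of_continuous hb (hψ k).continuous
  have t1 := tendsto_integral_norm_sq hm1 hu.memLp_fun hψu
  have t2 := tendsto_integral_norm_sq hm2 hu.memLp_grad hψG
  have t3 := tendsto_integral_norm_sq hm3 hg hψg
  simp only [Real.norm_eq_abs, sq_abs] at t1 t3
  -- The approximating sequence in `IsTrace` converges in all three L² norms, so the inequality
  -- passes to the limit.
  have hineq : α * ∫ x, g x ^ 2 ∂(boundaryMeasure Ω) ≤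
      (∫ x in Ω, ‖G x‖ ^ 2) + C * ∫ x in Ω, u x ^ 2 := by
    refine le_of_tendsto_of_tendsto' (t3.const_mul α) (t2.add (t1.const_mul C)) fun k => ?_
    refine (hC (ψ k) (hψ k)).trans_eq ?_
    rw [integral_add (hm2 k).norm.integrable_sq ((hm1 k).integrable_sq.const_mul C),
      integral_const_mul]
  have hpos : 0 < ∫ x in Ω, u x ^ 2 := by
    refine lt_of_le_of_ne (integral_nonneg fun x => sq_nonneg _) fun h => hu0 ?_
    have := (integral_eq_zero_iff_of_nonneg (fun x => sq_nonneg (u x))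
      hu.memLp_fun.integrable_sq).1 h.symm
    filter_upwards [this] with x hx
    simpa using hx
  rw [le_div_iff₀ hpos]
  linarith

/-- A smooth nowhere vanishing function is admissible in the Rayleigh quotient. -/
theorem mem_robinRayleighValues (hΩ : IsOpen Ω) (hb : Bornology.IsBounded Ω) (hne : Ω.Nonempty)
    [IsFiniteMeasure (boundaryMeasure Ω)] (α : ℝ) {ψ : Euc d → ℝ} (hψ : ContDiff ℝ ∞ ψ)
    (hψ0 : ∀ x, ψ x ≠ 0) :
    ((∫ x in Ω, ‖gradient ψ x‖ ^ 2) - α * ∫ x, ψ x ^ 2 ∂(boundaryMeasure Ω)) /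
      ∫ x in Ω, ψ x ^ 2 ∈ robinRayleighValues α Ω := by
  have hψ1 : ContDiff ℝ 1 ψ := hψ.of_le (by exact_mod_cast le_top)
  refine ⟨ψ, gradient ψ, ψ, ⟨memLp_restrict_of_continuous hΩ hb hψ.continuous,
    memLp_restrict_of_continuous hΩ hb (continuous_gradient hψ1), ?_⟩,
    ⟨memLp_boundaryMeasure_of_continuous hb hψ.continuous, fun _ => ψ, fun _ => hψ, ?_, ?_, ?_⟩,
    ?_, rfl⟩
  · intro φ hφ hφc hφΩ v
    have hφ1 : ContDiff ℝ 1 φ := hφ.of_le (by exact_mod_cast le_top)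
    have hφ' : Continuous fun x => fderiv ℝ φ x v :=
      (hφ1.continuous_fderiv one_ne_zero).clm_apply continuous_const
    have hψ' : Continuous fun x => fderiv ℝ ψ x v :=
      (hψ1.continuous_fderiv one_ne_zero).clm_apply continuous_const
    have hφ'c : HasCompactSupport fun x => fderiv ℝ φ x v := hφc.fderiv_apply ℝ v
    have hz : ∀ x, x ∉ Ω → φ x = 0 := fun x hx =>
      image_eq_zero_of_notMem_tsupport fun h => hx (hφΩ h)
    have hz' : ∀ x, x ∉ Ω → fderiv ℝ φ x v = 0 := fun x hx => by
      have : fderiv ℝ φ x = 0 :=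
        image_eq_zero_of_notMem_tsupport fun h => hx (hφΩ (tsupport_fderiv_subset ℝ h))
      simp [this]
    -- Since φ and its derivative vanish off Ω, integration by parts takes place on the whole space.
    rw [setIntegral_eq_integral_of_forall_compl_eq_zero fun x hx => by simp [hz' x hx],
      setIntegral_eq_integral_of_forall_compl_eq_zero fun x hx => by simp [hz x hx],
      integral_mul_fderiv_eq_neg_fderiv_mul_of_integrable
        ((hψ'.mul hφ.continuous).integrable_of_hasCompactSupport hφc.mul_left)
        ((hψ.continuous.mul hφ').integrable_of_hasCompactSupport hφ'c.mul_left)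
        ((hψ.continuous.mul hφ.continuous).integrable_of_hasCompactSupport hφc.mul_left)
        (fun x _ => hψ1.differentiable one_ne_zero x) (fun x _ => hφ1.differentiable one_ne_zero x)]
    simp only [inner_gradient_eq_fderiv, mul_comm]
  · simp
  · simp
  · simp
  · intro h
    have h1 : ∀ᵐ x ∂(volume.restrict Ω), False := h.mono fun x hx => hψ0 x hx
    have h2 : volume.restrict Ω = 0 := by simpa using h1
    rw [Measure.restrict_eq_zero] at h2
    exact (hΩ.measure_pos volume hne).ne' h2

/-- A smooth nowhere vanishing function with negative energy shows that the first eigenvalue is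
less than `-C`. -/
theorem robinFirstEigenvalue_lt (hΩ : IsOpen Ω) (hb : Bornology.IsBounded Ω) (hne : Ω.Nonempty)
    [IsFiniteMeasure (boundaryMeasure Ω)] {α C : ℝ} (hbdd : BddBelow (robinRayleighValues α Ω))
    {ψ : Euc d → ℝ} (hψ : ContDiff ℝ ∞ ψ) (hψ0 : ∀ x, ψ x ≠ 0)
    (hlt : ∫ x in Ω, (‖gradient ψ x‖ ^ 2 + C * ψ x ^ 2) < α * ∫ x, ψ x ^ 2 ∂(boundaryMeasure Ω)) :
    robinFirstEigenvalue α Ω < -C := by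
  refine (csInf_le hbdd (mem_robinRayleighValues hΩ hb hne α hψ hψ0)).trans_lt ?_
  have hψ1 : ContDiff ℝ 1 ψ := hψ.of_le (by exact_mod_cast le_top)
  have hm1 := memLp_restrict_of_continuous hΩ hb hψ.continuous
  have hm2 := memLp_restrict_of_continuous hΩ hb (continuous_gradient hψ1)
  rw [integral_add hm2.norm.integrable_sq (hm1.integrable_sq.const_mul C),
    integral_const_mul] at hlt
  have hpos : 0 < ∫ x in Ω, ψ x ^ 2 := by
    rw [setIntegral_pos_iff_support_of_nonneg_ae (ae_of_all _ fun x => sq_nonneg _)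
      hm1.integrable_sq]
    have : Function.support (fun x => ψ x ^ 2) = univ := by
      ext x; simp [hψ0 x]
    rw [this, univ_inter]
    exact hΩ.measure_pos volume hne
  rw [div_lt_iff₀ hpos]
  linarith

end RayleighQuotient

/-! ### Comparison of the ball and the annulus -/

section Comparison

variable {n : ℕ}

theorem isOpen_annulus (a b : ℝ) : IsOpen (annulus (n + 1) a b) := by
  rw [annulus_eq]
  exact isOpen_Ioo.preimage continuous_norm

theorem isBounded_annulus (a b : ℝ) : Bornology.IsBounded (annulus (n + 1) a b) :=
  Metric.isBounded_ball.subset Set.sdiff_subset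

theorem annulus_nonempty {a b : ℝ} (ha : 0 ≤ a) (hab : a < b) :
    (annulus (n + 1) a b).Nonempty := by
  obtain ⟨x, hx⟩ := exists_norm_eq (Euc (n + 1)) (show 0 ≤ (a + b) / 2 by linarith)
  refine ⟨x, ?_⟩
  rw [annulus_eq, mem_preimage, hx]
  constructor <;> linarith

theorem volume_annulus_eq_iff {a b r : ℝ} (ha : 0 < a) (hab : a < b) (hr : 0 < r) :
    volume (annulus (n + 1) a b) = volume (originBall (n + 1) r) ↔
      b ^ (n + 1) = r ^ (n + 1) + a ^ (n + 1) := by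
  have hb : 0 < b := ha.trans hab
  set V := (volume : Measure (Euc (n + 1))).real (Metric.ball 0 1)
  have hV : 0 < V :=
    ENNReal.toReal_pos (Metric.measure_ball_pos _ _ one_pos).ne' measure_ball_lt_top.ne
  have hball : ∀ t : ℝ, 0 < t →
      (volume : Measure (Euc (n + 1))).real (Metric.ball 0 t) = t ^ (n + 1) * V := fun t ht => by
    simp only [V, measureReal_def]
    rw [Measure.addHaar_ball _ _ ht.le, ENNReal.toReal_mul,
      ENNReal.toReal_ofReal (by positivity)]
    simp
  have hcball : (volume : Measure (Euc (n + 1))).real (Metric.closedBall 0 a) = a ^ (n + 1) * V := by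
    rw [← hball a ha, measureReal_def, measureReal_def, Measure.addHaar_closedBall_eq_addHaar_ball]
  rw [← ENNReal.toReal_eq_toReal_iff' (isBounded_annulus a b).measure_lt_top.ne
    (Metric.isBounded_ball.measure_lt_top (μ := volume) (s := originBall (n + 1) r)).ne,
    ← measureReal_def, ← measureReal_def, originBall, hball r hr, annulus,
    measureReal_sdiff (Metric.closedBall_subset_ball hab) Metric.isClosed_closedBall.measurableSet,
    hball b hb, hcball, ← sub_mul, mul_left_inj' hV.ne', sub_eq_iff_eq_add]

/-- The weighted trace inequality on a ball whose optimal constant comes from the radial ground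
state. -/
theorem ball_trace_inequality {β r μ : ℝ} {f f' : ℝ → ℝ} (hr : 0 < r)
    (hf : IsRadialGroundState n β r μ f f') {ψ : Euc (n + 1) → ℝ} (hψ : ContDiff ℝ 1 ψ) :
    β * r ^ n * ∫ w : Metric.sphere (0 : Euc (n + 1)) 1, ψ (r • (w : Euc (n + 1))) ^ 2
        ∂(volume : Measure (Euc (n + 1))).toSphere ≤
      ∫ x in originBall (n + 1) r, (‖gradient ψ x‖ ^ 2 + μ * ψ x ^ 2) := by
  have hpos : ∀ s, f s ≠ 0 := fun s => (one_pos.trans_le (hf.one_le s)).ne'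
  have hfc : Continuous f := continuous_iff_continuousAt.2 fun s => (hf.hasDerivAt s).continuousAt
  have hf'c : Continuous f' := hf.differentiable_deriv.continuous
  -- P = sⁿf'/f satisfies the Riccati condition with equality. The term at s = 0 drops out because
  -- f'(0) = 0, which matters when n = 0.
  have h := shell_trace_inequality (E := Euc (n + 1)) (n := n) (by simp) le_rfl hr.le (C := μ)
    (P := fun s => s ^ n * f' s / f s)
    (P' := fun s => (μ * s ^ n * f s * f s - s ^ n * f' s * f' s) / f s ^ 2)
    (fun s _ => (hf.hasDerivAt_flux s).div (hf.hasDerivAt s) (hpos s))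
    (Continuous.continuousOn (Continuous.div (by fun_prop) (by fun_prop)
      fun s => pow_ne_zero 2 (hpos s)))
    (fun s _ => le_of_eq (by have := hpos s; field_simp; ring)) hψ
  simp only [hf.deriv_zero, hf.deriv_eq, mul_zero, zero_div, zero_mul, sub_zero] at h
  rw [setIntegral_congr_set (originBall_ae_eq r)]
  refine le_trans (le_of_eq ?_) h
  congr 1
  have := hpos r
  field_simp

/-- A weighted trace inequality on an annulus. -/
theorem exists_annulus_trace_inequality (n : ℕ) {β a b : ℝ} (ha : 0 < a) (hab : a < b) :
    ∃ C : ℝ, ∀ ψ : Euc (n + 1) → ℝ, ContDiff ℝ 1 ψ →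
    β * b ^ n * (∫ w : Metric.sphere (0 : Euc (n + 1)) 1, ψ (b • (w : Euc (n + 1))) ^ 2
        ∂(volume : Measure (Euc (n + 1))).toSphere) +
      β * a ^ n * (∫ w : Metric.sphere (0 : Euc (n + 1)) 1, ψ (a • (w : Euc (n + 1))) ^ 2
        ∂(volume : Measure (Euc (n + 1))).toSphere) ≤
      ∫ x in annulus (n + 1) a b, (‖gradient ψ x‖ ^ 2 + C * ψ x ^ 2) := by
  have hba : b - a ≠ 0 := (sub_pos.2 hab).ne'
  -- The second factor runs linearly from -β at a to β at b, so both boundary terms get the right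
  -- sign. As s stays away from 0, some finite C suffices.
  set P : ℝ → ℝ := fun s => s ^ n * (β * (2 * s - a - b) / (b - a)) with hPdef
  set P' : ℝ → ℝ := fun s => n * s ^ (n - 1) * (β * (2 * s - a - b) / (b - a)) +
    s ^ n * (β * 2 / (b - a)) with hP'def
  have hP : ∀ s, HasDerivAt P (P' s) s := fun s => by
    have h1 : HasDerivAt (fun s : ℝ => β * (2 * s - a - b) / (b - a)) (β * 2 / (b - a)) s := by
      have h2 : HasDerivAt (fun s : ℝ => 2 * s - a - b) 2 s := by
        simpa using (((hasDerivAt_id s).const_mul 2).sub_const a).sub_const b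
      exact (h2.const_mul β).div_const _
    exact (hasDerivAt_pow n s).mul h1
  have hPc : Continuous P := by fun_prop
  have hP'c : Continuous P' := by fun_prop
  obtain ⟨C, hC⟩ := isCompact_Icc.exists_bound_of_continuousOn
    (f := fun s => (P s ^ 2 + P' s * s ^ n) / (s ^ n * s ^ n)) (s := Icc a b)
    (ContinuousOn.div (by fun_prop) (by fun_prop) fun s hs => by
      have : 0 < s := ha.trans_le hs.1
      positivity)
  refine ⟨C, fun ψ hψ => ?_⟩
  have h := shell_trace_inequality (E := Euc (n + 1)) (n := n) (by simp) ha.le hab.le (C := C)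
    (fun s _ => hP s) hP'c.continuousOn (fun s hs => by
      have hs0 : 0 < s := ha.trans hs.1
      have h1 := (le_abs_self _).trans (hC s (Ioo_subset_Icc_self hs))
      rwa [div_le_iff₀ (by positivity), ← mul_assoc] at h1) hψ
  have hPb : P b = β * b ^ n := by
    simp only [hPdef]; field_simp; ring
  have hPa : P a = -(β * a ^ n) := by
    simp only [hPdef]; field_simp; ring
  rw [hPb, hPa, neg_mul, sub_neg_eq_add] at h
  rwa [annulus_eq]

/-- The energy of the radial ground state on an annulus. -/
theorem integral_annulus_radialGroundState {β r μ a b : ℝ} {f f' : ℝ → ℝ} (ha : 0 ≤ a)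
    (hab : a ≤ b) (hf : IsRadialGroundState n β r μ f f') :
    ∫ x in annulus (n + 1) a b,
      (‖gradient (fun x : Euc (n + 1) => f ‖x‖) x‖ ^ 2 + μ * f ‖x‖ ^ 2) =
    (volume : Measure (Euc (n + 1))).toSphere.real univ *
      (b ^ n * f' b * f b - a ^ n * f' a * f a) := by
  have hfc : Continuous f := continuous_iff_continuousAt.2 fun s => (hf.hasDerivAt s).continuousAt
  have hf'c : Continuous f' := hf.differentiable_deriv.continuous
  simp only [hf.norm_gradient]
  rw [annulus_eq, (setIntegral_shell (E := Euc (n + 1)) (n := n) (by simp) ha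
    (f := fun x => f' ‖x‖ ^ 2 + μ * f ‖x‖ ^ 2) (by fun_prop)).2]
  have hray : ∀ w : Metric.sphere (0 : Euc (n + 1)) 1,
      ∫ s in Ioo a b, s ^ n * (f' ‖s • (w : Euc (n + 1))‖ ^ 2 +
        μ * f ‖s • (w : Euc (n + 1))‖ ^ 2) = b ^ n * f' b * f b - a ^ n * f' a * f a := by
    intro w
    -- The weighted energy density is the derivative of the flux sⁿf'f, by (sⁿf')' = μsⁿf.
    have hd : ∀ s ∈ uIcc a b, HasDerivAt (fun s => s ^ n * f' s * f s)
        (s ^ n * (f' s ^ 2 + μ * f s ^ 2)) s := fun s _ => by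
      refine ((hf.hasDerivAt_flux s).mul (hf.hasDerivAt s)).congr_deriv ?_
      ring
    rw [← intervalIntegral.integral_eq_sub_of_hasDerivAt hd
      ((by fun_prop : Continuous fun s => s ^ n * (f' s ^ 2 + μ * f s ^ 2)).intervalIntegrable a b),
      intervalIntegral.integral_of_le hab, integral_Ioc_eq_integral_Ioo]
    refine setIntegral_congr_fun measurableSet_Ioo fun s hs => ?_
    have hs0 : 0 < s := ha.trans_lt hs.1
    have hn : ‖s • (w : Euc (n + 1))‖ = s := by simp [norm_smul, abs_of_pos hs0]
    simp only [hn]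
  simp only [hray, integral_const, smul_eq_mul]

/-- For a small hole the boundary contribution of the hole dominates the change of the outer
radius. -/
theorem exists_forall_flux_lt {β r μ : ℝ} {f f' : ℝ → ℝ} (hβ : 0 < β) (hr : 0 < r)
    (hf : IsRadialGroundState n β r μ f f') :
    ∃ ε₀ : ℝ, 0 < ε₀ ∧ ε₀ ≤ r ∧ ∀ a b : ℝ, 0 < a → a < ε₀ → r < b →
      b ^ (n + 1) = r ^ (n + 1) + a ^ (n + 1) →
      b ^ n * f' b * f b - a ^ n * f' a * f a < β * (b ^ n * f b ^ 2 + a ^ n * f a ^ 2) := by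
  set H : ℝ → ℝ := fun s => s ^ n * f s * (f' s - β * f s) with hH
  have hHd : DifferentiableAt ℝ H r := by
    have h1 : Differentiable ℝ f := fun s => (hf.hasDerivAt s).differentiableAt
    have h2 := hf.differentiable_deriv
    fun_prop
  have hHr : H r = 0 := by simp [hH, hf.deriv_eq]
  obtain ⟨K, hK0, hK⟩ := hHd.isBigO_sub.exists_pos
  obtain ⟨δ, hδ, hball⟩ := Metric.eventually_nhds_iff.1 hK.bound
  have hrn : 0 < r ^ n := pow_pos hr n
  -- a < r gives b - r ≤ a; a < δ then puts b where |H(b)| ≤ K(b - r); aK < βrⁿ makes this bound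
  -- smaller than βaⁿ.
  refine ⟨min (min r δ) (β * r ^ n / K), by positivity, (min_le_left _ _).trans (min_le_left _ _),
    fun a b ha hlt hb hvol => ?_⟩
  have har : a < r := hlt.trans_le ((min_le_left _ _).trans (min_le_left _ _))
  have haδ : a < δ := hlt.trans_le ((min_le_left _ _).trans (min_le_right _ _))
  have haK : a * K < β * r ^ n := (lt_div_iff₀ hK0).1 (hlt.trans_le (min_le_right _ _))
  have han : 0 < a ^ n := pow_pos ha n
  -- The left side is at most bⁿ⁺¹ - rⁿ⁺¹ = aⁿ⁺¹: the outer radius moves one order less than the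
  -- area of the hole's boundary.
  have h1 : (b - r) * r ^ n ≤ a * a ^ n := by
    have h2 : r ^ n ≤ b ^ n := pow_le_pow_left₀ hr.le hb.le n
    have h3 : b * r ^ n ≤ b * b ^ n := mul_le_mul_of_nonneg_left h2 (hr.trans hb).le
    rw [pow_succ, pow_succ, pow_succ] at hvol
    linarith
  have h4 : b - r ≤ a := by
    have h5 : a ^ n ≤ r ^ n := pow_le_pow_left₀ ha.le har.le n
    have h6 : (b - r) * r ^ n ≤ a * r ^ n := h1.trans (mul_le_mul_of_nonneg_left h5 ha.le)
    exact le_of_mul_le_mul_right h6 hrn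
  have h7 : |H b| ≤ K * (b - r) := by
    have := hball (y := b) (by rw [Real.dist_eq, abs_of_pos (sub_pos.2 hb)]; linarith)
    rwa [hHr, sub_zero, Real.norm_eq_abs, Real.norm_eq_abs, abs_of_pos (sub_pos.2 hb)] at this
  have h8 : K * (b - r) < β * a ^ n := by
    have h9 : K * (b - r) * r ^ n < β * a ^ n * r ^ n := by
      calc K * (b - r) * r ^ n = K * ((b - r) * r ^ n) := by ring
        _ ≤ K * (a * a ^ n) := by gcongr
        _ = a * K * a ^ n := by ring
        _ < β * r ^ n * a ^ n := by gcongr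
        _ = β * a ^ n * r ^ n := by ring
    exact lt_of_mul_lt_mul_right h9 hrn.le
  have h10 : β * a ^ n ≤ β * a ^ n * f a ^ 2 :=
    le_mul_of_one_le_right (by positivity) (one_le_pow₀ (hf.one_le a))
  have h11 : 0 ≤ a ^ n * f' a * f a :=
    mul_nonneg (mul_nonneg han.le (hf.deriv_nonneg a ha.le)) (zero_le_one.trans (hf.one_le a))
  have h12 : H b = b ^ n * f' b * f b - β * (b ^ n * f b ^ 2) := by simp only [hH]; ring
  have h13 := (le_abs_self (H b)).trans h7
  rw [h12] at h13
  rw [mul_add, ← mul_assoc β (a ^ n)]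
  linarith

end Comparison

/-! ### The main theorem -/

/-- `BddBelow` expresses λ₁ > -∞: a real `sInf` is 0 by default on a set unbounded below, so the
inequality alone would not say enough. -/
theorem mainTheorem4 (d : ℕ) (hd : 1 ≤ d) (α r : ℝ) (hα : 0 < α) (hr : 0 < r) :
    BddBelow (robinRayleighValues α (originBall d r)) ∧
    ∃ ε₀ : ℝ, 0 < ε₀ ∧ ∀ ε : ℝ, 0 < ε → ε < ε₀ →
      (∃ r' : ℝ, r < r' ∧ volume (annulus d ε r') = volume (originBall d r)) ∧
      ∀ r' : ℝ, r < r' → volume (annulus d ε r') = volume (originBall d r) →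
        BddBelow (robinRayleighValues α (annulus d ε r')) ∧
        robinFirstEigenvalue α (annulus d ε r') < robinFirstEigenvalue α (originBall d r) := by
  obtain ⟨n, rfl⟩ : ∃ n, d = n + 1 := ⟨d - 1, by omega⟩
  obtain ⟨c, hc, hball, hann⟩ := exists_integral_boundaryMeasure n
  have hβ : 0 < α * c := mul_pos hα hc
  obtain ⟨μ, hμ, f, f', hf⟩ := exists_isRadialGroundState n hβ hr
  obtain ⟨ε₀, hε₀, hε₀r, hflux⟩ := exists_forall_flux_lt hβ hr hf
  have hle : ∀ ψ : Euc (n + 1) → ℝ, ContDiff ℝ ∞ ψ → ContDiff ℝ 1 ψ := fun ψ hψ =>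
    hψ.of_le (by exact_mod_cast le_top)
  have hlower : ∀ q ∈ robinRayleighValues α (originBall (n + 1) r), -μ ≤ q := by
    obtain ⟨hfin, hint⟩ := hball r hr
    refine fun q hq => neg_le_of_mem_robinRayleighValues (Ω := originBall (n + 1) r)
      Metric.isOpen_ball Metric.isBounded_ball (fun ψ hψ => ?_) hq
    rw [hint (fun x => ψ x ^ 2) (hψ.continuous.pow 2), ← mul_assoc, ← mul_assoc]
    exact ball_trace_inequality hr hf (hle ψ hψ)
  -- Needed because `sInf ∅ = 0`; the constant 1 is admissible.
  have hneB : (robinRayleighValues α (originBall (n + 1) r)).Nonempty := by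
    obtain ⟨hfin, -⟩ := hball r hr
    exact ⟨_, mem_robinRayleighValues (Ω := originBall (n + 1) r) Metric.isOpen_ball Metric.isBounded_ball
      ⟨0, Metric.mem_ball_self hr⟩ α (contDiff_const (c := (1 : ℝ))) fun _ => one_ne_zero⟩
  refine ⟨⟨-μ, hlower⟩, ε₀, hε₀, fun a ha haε => ⟨?_, fun b hb hvol => ?_⟩⟩
  · have hsum : 0 ≤ r ^ (n + 1) + a ^ (n + 1) := by positivity
    set b := (r ^ (n + 1) + a ^ (n + 1)) ^ (((n + 1 : ℕ) : ℝ)⁻¹)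
    have hbpow : b ^ (n + 1) = r ^ (n + 1) + a ^ (n + 1) :=
      Real.rpow_inv_natCast_pow hsum (Nat.succ_ne_zero n)
    have hrb : r < b := by
      refine lt_of_pow_lt_pow_left₀ (n + 1) (Real.rpow_nonneg hsum _) ?_
      rw [hbpow]
      exact lt_add_of_pos_right _ (by positivity)
    exact ⟨b, hrb, (volume_annulus_eq_iff ha ((haε.trans_le hε₀r).trans hrb) hr).2 hbpow⟩
  · have hab : a < b := (haε.trans_le hε₀r).trans hb
    obtain ⟨hfin, hint⟩ := hann a b ha hab
    obtain ⟨C, hC⟩ := exists_annulus_trace_inequality n (β := α * c) ha hab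
    have hbdd : BddBelow (robinRayleighValues α (annulus (n + 1) a b)) := by
      refine ⟨-C, fun q hq => neg_le_of_mem_robinRayleighValues (isOpen_annulus a b)
        (isBounded_annulus a b) (fun ψ hψ => ?_) hq⟩
      rw [hint (fun x => ψ x ^ 2) (hψ.continuous.pow 2), mul_add]
      simp only [← mul_assoc]
      exact hC ψ (hle ψ hψ)
    refine ⟨hbdd, lt_of_lt_of_le ?_ (le_csInf hneB hlower)⟩
    refine robinFirstEigenvalue_lt (isOpen_annulus a b) (isBounded_annulus a b)
      (annulus_nonempty ha.le hab) hbdd hf.contDiff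
      (fun x => (one_pos.trans_le (hf.one_le ‖x‖)).ne') ?_
    rw [integral_annulus_radialGroundState ha.le hab.le hf, 
      hint (fun x => f ‖x‖ ^ 2) (hf.contDiff.continuous.pow 2)]
    have hn : ∀ t : ℝ, 0 < t → ∀ w : Metric.sphere (0 : Euc (n + 1)) 1,
        ‖t • (w : Euc (n + 1))‖ = t := fun t ht w => by simp [norm_smul, abs_of_pos ht]
    simp only [hn a ha, hn b (ha.trans hab), integral_const, smul_eq_mul]
    have hS : 0 < (volume : Measure (Euc (n + 1))).toSphere.real univ := by
      rw [Measure.toSphere_real_apply_univ]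
      have : 0 < (volume : Measure (Euc (n + 1))).real (Metric.ball 0 1) :=
        ENNReal.toReal_pos (Metric.measure_ball_pos _ _ one_pos).ne' measure_ball_lt_top.ne
      simp only [finrank_euclideanSpace, Fintype.card_fin]
      positivity
    have := mul_lt_mul_of_pos_left
      (hflux a b ha haε hb ((volume_annulus_eq_iff ha hab hr).1 hvol)) hS
    refine this.trans_eq ?_
    ring
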